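/- Closed formulas of interpretability logic are built from primitive symbols among $\bot,\top$ by connectives among $\to,\rhd,\Box$; the complexity of a formula is its number of connectives. For an alphabet $\Sigma$ let $\mathcal F_n$ be the finite set of closed formulas over $\Sigma$ of complexity $n$. The share of a class $\mathcal P$ of formulas is $\mu(\mathcal P)=\lim_{n\to\infty}\#\{F\in\mathcal F_n:\mathcal P(F)\}/\#\mathcal F_n$, if this limit exists. Define classes of formulas by the following grammar rules, where $F$ stands for an arbitrary formula and where only the rules whose symbols belong to $\Sigma$ are used: - affirmative: $A::=\top\mid\Box F\mid F\rhd F\mid N\to F\mid F\to A$; - negative: $N::=\bot\mid A\to N$; - direct: $M::=\Box N\mid A\rhd N$; - cross: $X::=M\to\bot$; - basic locally GL-like: $B::=\Box N\mid\Box M\mid\bot\rhd F\mid F\rhd A\mid A\rhd\bot\mid N\rhd X\mid X\rhd\bot$; - locally GL-like: $L::=\bot\mid\top\mid B\mid F\to\top\mid L\to L$; - GL-like: $G::=L\mid N\mid M\mid\Box G\mid(G\to\bot)\rhd\bot\mid\top\to G$. **Theorem.** The share $\mu(\text{GL-like})$ exists for each of the following three alphabets, and (a) $\mu(\text{GL-like})=0.93771\ldots$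 if $\Sigma=\{\bot,\to,\rhd\}$; (b) $\mu(\text{GL-like})=0.86653\ldots$ if $\Sigma=\{\bot,\to,\rhd,\Box\}$; (c) $\mu(\text{GL-like})=0.90519\ldots$ if $\Sigma=\{\bot,\top,\to,\rhd,\Box\}$ (the digits shown are the first five decimals). As a consequence, a majority of closed formulas have GL-equivalents. Precisely, let $\mathcal E$ be the class of closed formulas $F$ for which there is a $\rhd$-free closed formula $F_1$ (over $\bot,\top,\to,\Box$) that is globally equivalent to $F$, i.e. each of $F$ and $F_1$ is derivable in the interpretability logic IL from the other one as an additional axiom (IL has as axioms all tautologies, $\Box(A\to B)\to(\Box A\to\Box B)$, $\Box(\Box A\to A)\to\Box A$, $\Box(A\to B)\to A\rhd B$, $(A\rhd B\wedge B\rhd C)\to A\rhd C$, $(A\rhd C\wedge B\rhd C)\to(A\vee B)\rhd C$, $A\rhd B\to(\Diamond A\to\Diamond B)$, $\Diamond A\rhd A$, and as rules modus ponens and necessitation). Then, for each of the three alphabets, $$\liminf_{n\to\infty}\frac{\#\{F\in\mathcal F_n : F\in\mathcal E\}}{\#\mathcal F_n}\ \ge\ \mu(\text{GL-like})\ >\ \tfrac12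 .$$ -/

import Mathlib

namespace IL

/-- The logical symbols. -/
inductive Symbol
  | bot | top | imp | rhd | box

/-- Closed formulas of interpretability logic over the full alphabet `⊥, ⊤, →, ▷, □`. -/
inductive Formula
  | bot : Formula
  | top : Formula
  | imp : Formula → Formula → Formula
  | rhd : Formula → Formula → Formula
  | box : Formula → Formula

namespace Formula

/-- The set of symbols that occur in a formula. -/
def symbols : Formula → Set Symbol
  | bot => {Symbol.bot}
  | top => {Symbol.top}
  | imp A B => {Symbol.imp} ∪ (A.symbols ∪ B.symbols)
  | rhd A B => {Symbol.rhd} ∪ (A.symbols ∪ B.symbols)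
  | box A => {Symbol.box} ∪ A.symbols

/-- The number of connectives `→`, `▷`, `□`. -/
def complexity : Formula → ℕ
  | bot => 0
  | top => 0
  | imp A B => A.complexity + B.complexity + 1
  | rhd A B => A.complexity + B.complexity + 1
  | box A => A.complexity + 1

/-- `¬A`, as an abbreviation. -/
def neg (A : Formula) : Formula := imp A bot

/-- `A ∨ B`, as an abbreviation. -/
def or (A B : Formula) : Formula := imp (neg A) B

/-- `◇A`, as an abbreviation. -/
def dia (A : Formula) : Formula := neg (box (neg A))

end Formula

open Formula

/-! ### The share of a class of formulas -/

/-- The closed formulas of complexity `n` over the alphabet `S`. -/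
def formulas (S : Set Symbol) (n : ℕ) : Set Formula :=
  {F | F.symbols ⊆ S ∧ F.complexity = n}

theorem finite_complexity_lt (n : ℕ) : {F : Formula | F.complexity < n}.Finite := by
  induction n with
  | zero => simp
  | succ n ih =>
    refine (((Set.toFinite {bot, top}).union ((ih.image2 imp ih).union
      (ih.image2 rhd ih))).union (ih.image box)).subset ?_
    intro F hF
    simp only [Set.mem_ofPred_eq] at hF
    cases F with
    | bot => simp
    | top => simp
    | imp A B =>
      simp only [complexity] at hF
      exact Or.inl (Or.inr (Or.inl ⟨A, by simp; omega, B, by simp; omega, rfl⟩))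
    | rhd A B =>
      simp only [complexity] at hF
      exact Or.inl (Or.inr (Or.inr ⟨A, by simp; omega, B, by simp; omega, rfl⟩))
    | box A =>
      simp only [complexity] at hF
      exact Or.inr ⟨A, by simp; omega, rfl⟩

/-- The cardinalities in `shareAt` are cardinalities of finite sets. -/
theorem finite_formulas (S : Set Symbol) (n : ℕ) : (formulas S n).Finite :=
  (finite_complexity_lt (n + 1)).subset fun _ hF => Nat.lt_succ_of_le hF.2.le

/-- The proportion of formulas with the property `P` among the formulas of complexity `n` over
the alphabet `S`. -/
noncomputable def shareAt (S : Set Symbol) (P : Formula → Prop) (n : ℕ) : ℝ :=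
  ({F ∈ formulas S n | P F}.ncard : ℝ) / ((formulas S n).ncard : ℝ)

/-- The property `P` has share `μ` among the closed formulas over the alphabet `S`. -/
def HasShare (S : Set Symbol) (P : Formula → Prop) (μ : ℝ) : Prop :=
  Filter.Tendsto (shareAt S P) Filter.atTop (nhds μ)

/-! ### The syntactic classes

The rules are stated over the full alphabet. All premises of a rule concern subformulas of the
formula in its conclusion, so on the formulas over a smaller alphabet the classes are the ones
generated by those rules that mention only symbols of that alphabet. -/

mutual

/-- `A ::= ⊤ | □F | F ▷ F | N → F | F → A`. -/
inductive Affirmative : Formula → Prop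
  | top : Affirmative top
  | box (F : Formula) : Affirmative (box F)
  | rhd (F F' : Formula) : Affirmative (rhd F F')
  | imp_left (N F : Formula) : Negative N → Affirmative (imp N F)
  | imp_right (F A : Formula) : Affirmative A → Affirmative (imp F A)

/-- `N ::= ⊥ | A → N`. -/
inductive Negative : Formula → Prop
  | bot : Negative bot
  | imp (A N : Formula) : Affirmative A → Negative N → Negative (imp A N)

end

/-- `M ::= □N | A ▷ N`. -/
inductive Direct : Formula → Prop
  | box (N : Formula) : Negative N → Direct (box N)
  | rhd (A N : Formula) : Affirmative A → Negative N → Direct (rhd A N)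

/-- `X ::= M → ⊥`. -/
inductive Cross : Formula → Prop
  | imp (M : Formula) : Direct M → Cross (imp M bot)

/-- `B ::= □N | □M | ⊥ ▷ F | F ▷ A | A ▷ ⊥ | N ▷ X | X ▷ ⊥`. -/
inductive BasicLocallyGLLike : Formula → Prop
  | box_negative (N : Formula) : Negative N → BasicLocallyGLLike (box N)
  | box_direct (M : Formula) : Direct M → BasicLocallyGLLike (box M)
  | bot_rhd (F : Formula) : BasicLocallyGLLike (rhd bot F)
  | rhd_affirmative (F A : Formula) : Affirmative A → BasicLocallyGLLike (rhd F A)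
  | affirmative_rhd_bot (A : Formula) : Affirmative A → BasicLocallyGLLike (rhd A bot)
  | negative_rhd_cross (N X : Formula) :
      Negative N → Cross X → BasicLocallyGLLike (rhd N X)
  | cross_rhd_bot (X : Formula) : Cross X → BasicLocallyGLLike (rhd X bot)

/-- `L ::= ⊥ | ⊤ | B | F → ⊤ | L → L`. -/
inductive LocallyGLLike : Formula → Prop
  | bot : LocallyGLLike bot
  | top : LocallyGLLike top
  | basic (B : Formula) : BasicLocallyGLLike B → LocallyGLLike B
  | imp_top (F : Formula) : LocallyGLLike (imp F top)
  | imp (L L' : Formula) : LocallyGLLike L → LocallyGLLike L' → LocallyGLLike (imp L L')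

/-- `G ::= L | N | M | □G | (G → ⊥) ▷ ⊥ | ⊤ → G`. -/
inductive GLLike : Formula → Prop
  | locally (L : Formula) : LocallyGLLike L → GLLike L
  | negative (N : Formula) : Negative N → GLLike N
  | direct (M : Formula) : Direct M → GLLike M
  | box (G : Formula) : GLLike G → GLLike (box G)
  | rhd (G : Formula) : GLLike G → GLLike (rhd (imp G bot) bot)
  | top_imp (G : Formula) : GLLike G → GLLike (imp top G)

/-! ### The logic IL and GL-equivalents -/

/-- Propositional tautologies: formulas true under every assignment of truth values that respects
`⊥`, `⊤` and `→` (formulas `□A` and `A ▷ B` are treated as propositional atoms). -/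
def Tautology (F : Formula) : Prop :=
  ∀ v : Formula → Prop, ¬ v bot → v top → (∀ A B, v (imp A B) ↔ (v A → v B)) → v F

/-- Derivability in the logic `IL` from global assumptions `Γ`: necessitation may be applied to
everything derived. Conjunctions of premises are written as iterated implications. -/
inductive Derives (Γ : Set Formula) : Formula → Prop
  | assumption (A : Formula) : A ∈ Γ → Derives Γ A
  | taut (A : Formula) : Tautology A → Derives Γ A
  | axK (A B : Formula) : Derives Γ (imp (box (imp A B)) (imp (box A) (box B)))
  | axL (A : Formula) : Derives Γ (imp (box (imp (box A) A)) (box A))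
  | axJ1 (A B : Formula) : Derives Γ (imp (box (imp A B)) (rhd A B))
  | axJ2 (A B C : Formula) : Derives Γ (imp (rhd A B) (imp (rhd B C) (rhd A C)))
  | axJ3 (A B C : Formula) : Derives Γ (imp (rhd A C) (imp (rhd B C) (rhd (or A B) C)))
  | axJ4 (A B : Formula) : Derives Γ (imp (rhd A B) (imp (dia A) (dia B)))
  | axJ5 (A : Formula) : Derives Γ (rhd (dia A) A)
  | mp (A B : Formula) : Derives Γ (imp A B) → Derives Γ A → Derives Γ B
  | nec (A : Formula) : Derives Γ A → Derives Γ (box A)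

/-- Global equivalence over `IL`. -/
def GlobalEquiv (F G : Formula) : Prop :=
  Derives {F} G ∧ Derives {G} F

/-- `F` is globally equivalent over `IL` to a closed formula of the provability logic `GL`, i.e.
to one without `▷`. -/
def HasGLEquivalent (F : Formula) : Prop :=
  ∃ G : Formula, Symbol.rhd ∉ G.symbols ∧ GlobalEquiv F G

end IL

namespace IL

open Formula

/-! ### Derivations in `IL` -/

namespace Derives

variable {Γ : Set Formula} {A B C D : Formula}

theorem of_taut_imp (h : Tautology (imp A B)) (hA : Derives Γ A) : Derives Γ B :=
  .mp A B (.taut _ h) hA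

theorem of_taut_imp₂ (h : Tautology (imp A (imp B C))) (hA : Derives Γ A)
    (hB : Derives Γ B) : Derives Γ C :=
  .mp B C (of_taut_imp h hA) hB

theorem imp_const (h : Derives Γ B) : Derives Γ (imp A B) :=
  of_taut_imp (fun v _ _ hi => by simp only [hi]; tauto) h

theorem refl : Derives Γ (imp A A) := .taut _ fun v _ _ hi => by simp only [hi]; tauto

theorem imp_trans (h₁ : Derives Γ (imp A B)) (h₂ : Derives Γ (imp B C)) : Derives Γ (imp A C) :=
  of_taut_imp₂ (fun v _ _ hi => by simp only [hi]; tauto) h₁ h₂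

theorem mp₂ (h₁ : Derives Γ (imp A (imp B C))) (h₂ : Derives Γ (imp A B)) :
    Derives Γ (imp A C) :=
  of_taut_imp₂ (fun v _ _ hi => by simp only [hi]; tauto) h₁ h₂

theorem box_mono (h : Derives Γ (imp A B)) : Derives Γ (imp (box A) (box B)) :=
  .mp _ _ (.axK A B) (.nec _ h)

theorem box_mono₂ (h : Derives Γ (imp A (imp B C))) :
    Derives Γ (imp (box A) (imp (box B) (box C))) :=
  imp_trans (box_mono h) (.axK B C)

theorem rhd_of_imp (h : Derives Γ (imp A B)) : Derives Γ (rhd A B) :=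
  .mp _ _ (.axJ1 A B) (.nec _ h)

theorem rhd_trans (h₁ : Derives Γ (rhd A B)) (h₂ : Derives Γ (rhd B C)) :
    Derives Γ (rhd A C) :=
  .mp _ _ (.mp _ _ (.axJ2 A B C) h₁) h₂

theorem box_of_box_bot : Derives Γ (imp (box bot) (box A)) :=
  box_mono (.taut _ fun v hb _ hi => by simp only [hi]; tauto)

theorem rhd_of_box_bot : Derives Γ (imp (box bot) (rhd A B)) :=
  imp_trans (box_of_box_bot (A := imp A B)) (.axJ1 A B)

/-- Transitivity of provability follows from Löb's axiom. -/
theorem box_box : Derives Γ (imp (box A) (box (box A))) := by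
  let C := neg (imp A (neg (box A)))
  have h₁ : Derives Γ (imp (box C) (box A)) :=
    box_mono (.taut _ fun v hb _ hi => by simp only [C, neg, hi]; tauto)
  have h₂ : Derives Γ (imp A (imp (box C) C)) :=
    of_taut_imp (fun v hb _ hi => by simp only [C, neg, hi]; tauto) h₁
  have h₃ : Derives Γ (imp (box A) (box C)) := imp_trans (box_mono h₂) (.axL C)
  have h₄ : Derives Γ (imp (box C) (box (box A))) :=
    box_mono (.taut _ fun v hb _ hi => by simp only [C, neg, hi]; tauto)
  exact imp_trans h₃ h₄

/-- The deduction theorem for global derivability. -/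
theorem deduction (h : Derives {A} B) : Derives Γ (imp A (imp (box A) B)) := by
  induction h with
  | assumption B hB =>
    rw [Set.mem_singleton_iff] at hB
    subst hB
    exact .taut _ fun v _ _ hi => by simp only [hi]; tauto
  | taut B hB => exact imp_const (imp_const (.taut B hB))
  | axK B C => exact imp_const (imp_const (.axK B C))
  | axL B => exact imp_const (imp_const (.axL B))
  | axJ1 B C => exact imp_const (imp_const (.axJ1 B C))
  | axJ2 B C D => exact imp_const (imp_const (.axJ2 B C D))
  | axJ3 B C D => exact imp_const (imp_const (.axJ3 B C D))
  | axJ4 B C => exact imp_const (imp_const (.axJ4 B C))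
  | axJ5 B => exact imp_const (imp_const (.axJ5 B))
  | mp B C _ _ h₁ h₂ =>
    exact of_taut_imp₂ (fun v _ _ hi => by simp only [hi]; tauto) h₁ h₂
  | nec B _ h =>
    exact imp_const (mp₂ (box_mono₂ h) box_box)

theorem box_imp_box_of_derives (h : Derives {A} B) : Derives Γ (imp (box A) (box B)) :=
  mp₂ (box_mono₂ (deduction h)) box_box

theorem rhd_or (h₁ : Derives Γ (rhd A C)) (h₂ : Derives Γ (rhd B C)) :
    Derives Γ (rhd (or A B) C) :=
  .mp _ _ (.mp _ _ (.axJ3 A B C) h₁) h₂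

/-- Every formula interprets the same formula together with its own inconsistency. -/
theorem rhd_and_box_neg : Derives Γ (rhd A (neg (imp A (neg (box (neg A)))))) := by
  let C := neg (imp A (neg (box (neg A))))
  have h₁ : Derives Γ (imp (box (neg C)) (box (neg A))) := by
    refine imp_trans (box_mono ?_) (.axL (neg A))
    exact .taut _ fun v hb _ hi => by simp only [C, neg, hi]; tauto
  have h₂ : Derives Γ (imp A (or C (dia C))) :=
    of_taut_imp (fun v hb _ hi => by simp only [C, neg, Formula.or, dia, hi]; tauto) h₁
  exact rhd_trans (rhd_of_imp h₂) (rhd_or (rhd_of_imp refl) (.axJ5 C))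

theorem rhd_box_bot : Derives Γ (rhd A (box bot)) := by
  refine rhd_trans (rhd_of_imp (B := top) (.taut _ fun v _ ht hi => by simp only [hi]; tauto))
    (rhd_trans rhd_and_box_neg (rhd_of_imp ?_))
  have h : Derives Γ (imp (box (neg top)) (box bot)) :=
    box_mono (.taut _ fun v hb ht hi => by simp only [neg, hi]; tauto)
  exact of_taut_imp (fun v hb ht hi => by simp only [neg, hi]; tauto) h

theorem rhd_bot_imp : Derives Γ (imp (rhd A bot) (box (neg A))) := by
  have h : Derives Γ (box (neg bot)) :=
    .nec _ (.taut _ fun v hb ht hi => by simp only [neg, hi]; tauto)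
  exact of_taut_imp₂ (fun v hb ht hi => by simp only [neg, dia, hi]; tauto) (axJ4 A bot) h

theorem imp_rhd_bot : Derives Γ (imp (box (neg A)) (rhd A bot)) := .axJ1 A bot

end Derives

open Derives

variable {Γ : Set Formula}

/-! ### Affirmative, negative and direct formulas over `□⊥` -/

mutual

theorem affirmative_of_box_bot {A : Formula} (h : Affirmative A) :
    Derives Γ (imp (box bot) A) := by
  cases h with
  | top => exact .taut _ fun v _ ht hi => by simp only [hi]; tauto
  | box F => exact box_of_box_bot
  | rhd F F' => exact rhd_of_box_bot
  | imp_left N F hN =>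
    exact of_taut_imp (fun v hb _ hi => by simp only [neg, hi]; tauto) (negative_neg_of_box_bot hN)
  | imp_right F A hA =>
    exact of_taut_imp (fun v hb _ hi => by simp only [hi]; tauto) (affirmative_of_box_bot hA)

theorem negative_neg_of_box_bot {N : Formula} (h : Negative N) :
    Derives Γ (imp (box bot) (neg N)) := by
  cases h with
  | bot => exact .taut _ fun v hb _ hi => by simp only [neg, hi]; tauto
  | imp A N hA hN =>
    exact of_taut_imp₂ (fun v hb _ hi => by simp only [neg, hi]; tauto) (affirmative_of_box_bot hA)
      (negative_neg_of_box_bot hN)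

end

theorem negative_imp_neg_box_bot {N : Formula} (h : Negative N) :
    Derives Γ (imp N (neg (box bot))) :=
  of_taut_imp (fun v hb _ hi => by simp only [neg, hi]; tauto) (negative_neg_of_box_bot h)

theorem box_negative_imp_box_bot {N : Formula} (h : Negative N) :
    Derives Γ (imp (box N) (box bot)) :=
  imp_trans (box_mono (negative_imp_neg_box_bot h)) (.axL bot)

/-- A direct formula makes `□□⊥` collapse to `□⊥`. -/
theorem direct_imp_collapse {M : Formula} (h : Direct M) :
    Derives Γ (imp M (imp (box (box bot)) (box bot))) := by
  cases h with
  | box N hN =>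
    exact imp_trans (box_negative_imp_box_bot hN) (.taut _ fun v _ _ hi => by simp only [hi]; tauto)
  | rhd A N hA hN =>
    have h₁ : Derives Γ (rhd top A) := rhd_trans rhd_box_bot (rhd_of_imp (affirmative_of_box_bot hA))
    have h₂ : Derives Γ (rhd N (neg (box bot))) := rhd_of_imp (negative_imp_neg_box_bot hN)
    have h₃ : Derives Γ (imp (rhd A N) (rhd top N)) := .mp _ _ (.axJ2 _ _ _) h₁
    have h₄ : Derives Γ (imp (rhd top N) (imp (rhd N (neg (box bot))) (rhd top (neg (box bot))))) :=
      .axJ2 _ _ _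
    have h₅ : Derives Γ (imp (rhd A N) (rhd top (neg (box bot)))) :=
      imp_trans h₃ (mp₂ h₄ (imp_const h₂))
    have h₆ := imp_trans h₅ (axJ4 top (neg (box bot)))
    have h₇ : Derives Γ (imp (box (neg top)) (box bot)) :=
      box_mono (.taut _ fun v hb ht hi => by simp only [neg, hi]; tauto)
    have h₈ : Derives Γ (imp (box (box bot)) (box (neg (neg (box bot))))) :=
      box_mono (.taut _ fun v hb ht hi => by simp only [neg, hi]; tauto)
    refine Derives.mp _ _ (of_taut_imp₂ ?_ h₆ h₇) h₈
    intro v hb ht hi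
    simp only [neg, dia, hi]
    tauto

theorem affirmative_of_direct {M : Formula} (h : Direct M) : Affirmative M := by
  cases h with
  | box N _ => exact .box N
  | rhd A N _ _ => exact .rhd A N

theorem box_direct_imp {M : Formula} (h : Direct M) :
    Derives Γ (imp (box M) (box (box bot))) :=
  imp_trans (box_mono (direct_imp_collapse h)) (.axL _)

theorem imp_box_direct {M : Formula} (h : Direct M) :
    Derives Γ (imp (box (box bot)) (box M)) :=
  box_mono (affirmative_of_box_bot (affirmative_of_direct h))

theorem direct_derives_box_bot {M : Formula} (h : Direct M) : Derives {M} (box bot) := by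
  have h₁ : Derives {M} (imp (box (box bot)) (box bot)) :=
    .mp _ _ (direct_imp_collapse h) (.assumption _ rfl)
  exact .mp _ _ h₁ (.mp _ _ (.axL _) (.nec _ h₁))

/-! ### Local and global equivalents -/

/-- `F` is provably equivalent in `IL` to a formula without `▷`. -/
def HasLocalGLEquivalent (F : Formula) : Prop :=
  ∃ G : Formula, Symbol.rhd ∉ G.symbols ∧ ∀ Γ, Derives Γ (imp F G) ∧ Derives Γ (imp G F)

theorem hasLocalGLEquivalent_of_derives {F : Formula} (h : ∀ Γ, Derives Γ F) :
    HasLocalGLEquivalent F :=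
  ⟨top, by simp [symbols], fun Γ =>
    ⟨imp_const (.taut _ fun _ _ ht _ => ht), imp_const (h Γ)⟩⟩

theorem negative_rhd_cross {N X : Formula} (hN : Negative N) (hX : Cross X) :
    Derives Γ (rhd N X) := by
  obtain ⟨M, hM⟩ := hX
  refine rhd_trans (rhd_of_imp (negative_imp_neg_box_bot hN)) (rhd_trans rhd_and_box_neg (rhd_of_imp ?_))
  have h : Derives Γ (imp (box (neg (neg (box bot)))) (box (box bot))) :=
    box_mono (.taut _ fun v hb ht hi => by simp only [neg, hi]; tauto)
  exact of_taut_imp₂ (fun v hb ht hi => by simp only [neg, hi]; tauto) h (direct_imp_collapse hM)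

theorem hasLocalGLEquivalent_of_basicLocallyGLLike {F : Formula} (h : BasicLocallyGLLike F) :
    HasLocalGLEquivalent F := by
  cases h with
  | box_negative N hN => exact ⟨box bot, by simp [symbols], fun Γ => ⟨(box_negative_imp_box_bot hN), box_of_box_bot⟩⟩
  | box_direct M hM => exact ⟨box (box bot), by simp [symbols], fun Γ => ⟨(box_direct_imp hM), (imp_box_direct hM)⟩⟩
  | bot_rhd F =>
    exact hasLocalGLEquivalent_of_derives fun Γ =>
      rhd_of_imp (.taut _ fun v hb _ hi => by simp only [hi]; tauto)
  | rhd_affirmative F A hA =>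
    exact hasLocalGLEquivalent_of_derives fun Γ =>
      rhd_trans rhd_box_bot (rhd_of_imp (affirmative_of_box_bot hA))
  | affirmative_rhd_bot A hA =>
    refine ⟨box bot, by simp [symbols], fun Γ => ⟨imp_trans rhd_bot_imp ?_, rhd_of_box_bot⟩⟩
    refine imp_trans (box_mono ?_) (.axL bot)
    exact of_taut_imp (fun v hb _ hi => by simp only [neg, hi]; tauto) (affirmative_of_box_bot hA)
  | negative_rhd_cross N X hN hX =>
    exact hasLocalGLEquivalent_of_derives fun Γ => negative_rhd_cross hN hX
  | cross_rhd_bot X hX =>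
    obtain ⟨M, hM⟩ := hX
    refine ⟨box (box bot), by simp [symbols], fun Γ =>
      ⟨imp_trans rhd_bot_imp (imp_trans (box_mono ?_) (box_direct_imp hM)),
        imp_trans (imp_box_direct hM) (imp_trans (box_mono ?_) imp_rhd_bot)⟩⟩ <;>
    exact .taut _ fun v hb _ hi => by simp only [neg, hi]; tauto

theorem hasLocalGLEquivalent_of_locallyGLLike {F : Formula} (h : LocallyGLLike F) :
    HasLocalGLEquivalent F := by
  induction h with
  | bot => exact ⟨bot, by simp [symbols], fun Γ => ⟨refl, refl⟩⟩
  | top => exact ⟨top, by simp [symbols], fun Γ => ⟨refl, refl⟩⟩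
  | basic B hB => exact hasLocalGLEquivalent_of_basicLocallyGLLike hB
  | imp_top F =>
    exact hasLocalGLEquivalent_of_derives fun Γ =>
      .taut _ fun v _ ht hi => by simp only [hi]; tauto
  | imp L L' _ _ h h' =>
    obtain ⟨G, hG, hL⟩ := h
    obtain ⟨G', hG', hL'⟩ := h'
    refine ⟨imp G G', by simp [symbols, hG, hG'], fun Γ => ⟨?_, ?_⟩⟩
    · exact of_taut_imp₂ (fun v _ _ hi => by simp only [hi]; tauto) (hL Γ).2 (hL' Γ).1
    · exact of_taut_imp₂ (fun v _ _ hi => by simp only [hi]; tauto) (hL Γ).1 (hL' Γ).2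

theorem hasGLEquivalent_of_hasLocalGLEquivalent {F : Formula} (h : HasLocalGLEquivalent F) :
    HasGLEquivalent F := by
  obtain ⟨G, hG, h⟩ := h
  exact ⟨G, hG, .mp _ _ (h _).1 (.assumption _ rfl), .mp _ _ (h _).2 (.assumption _ rfl)⟩

theorem negative_derives_bot {N : Formula} (h : Negative N) : Derives {N} bot := by
  have h₁ : Derives {N} (neg (box bot)) := .mp _ _ (negative_imp_neg_box_bot h) (.assumption _ rfl)
  exact .mp _ _ h₁ (.mp _ _ (.axL _) (.nec _ h₁))

theorem hasGLEquivalent_of_gllike {F : Formula} (h : GLLike F) : HasGLEquivalent F := by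
  induction h with
  | locally L hL => exact hasGLEquivalent_of_hasLocalGLEquivalent (hasLocalGLEquivalent_of_locallyGLLike hL)
  | negative N hN =>
    refine ⟨bot, by simp [symbols], (negative_derives_bot hN), ?_⟩
    exact of_taut_imp (fun v hb _ hi => by simp only [hi]; tauto) (.assumption bot rfl)
  | direct M hM =>
    exact ⟨box bot, by simp [symbols], (direct_derives_box_bot hM),
      .mp _ _ (affirmative_of_box_bot (affirmative_of_direct hM)) (.assumption _ rfl)⟩
  | box G _ h =>
    obtain ⟨G', hG', h₁, h₂⟩ := h
    exact ⟨box G', by simp [symbols, hG'],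
      .mp _ _ (box_imp_box_of_derives h₁) (.assumption _ rfl),
      .mp _ _ (box_imp_box_of_derives h₂) (.assumption _ rfl)⟩
  | rhd G _ h =>
    obtain ⟨G', hG', h₁, h₂⟩ := h
    refine ⟨box G', by simp [symbols, hG'],
      .mp _ _ (imp_trans rhd_bot_imp (imp_trans (box_mono ?_) (box_imp_box_of_derives h₁)))
        (.assumption _ rfl),
      .mp _ _ (imp_trans (box_imp_box_of_derives h₂) (imp_trans (box_mono ?_) imp_rhd_bot))
        (.assumption _ rfl)⟩ <;>
    exact .taut _ fun v hb _ hi => by simp only [neg, hi]; tauto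
  | top_imp G _ h =>
    obtain ⟨G', hG', h₁, h₂⟩ := h
    have h₃ : Derives {imp top G} G :=
      of_taut_imp (fun v _ ht hi => by simp only [hi]; tauto) (.assumption _ rfl)
    refine ⟨G', hG', ?_, imp_const h₂⟩
    exact .mp _ _ (.mp _ _ (deduction h₁) h₃) (.nec _ h₃)

end IL

namespace IL

open Formula

/-! ### Recursive descriptions of the syntactic classes -/

theorem negative_imp_iff_aux {A B : Formula} :
    Negative (imp A B) ↔ Affirmative A ∧ Negative B :=
  ⟨fun h => by cases h with | imp _ _ hA hB => exact ⟨hA, hB⟩, fun h => .imp A B h.1 h.2⟩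

@[simp] theorem negative_bot : Negative bot := .bot
@[simp] theorem not_negative_top : ¬ Negative top := fun h => by cases h
@[simp] theorem not_negative_rhd (A B : Formula) : ¬ Negative (rhd A B) := fun h => by cases h
@[simp] theorem not_negative_box (A : Formula) : ¬ Negative (box A) := fun h => by cases h

theorem affirmative_iff (A : Formula) : Affirmative A ↔ ¬ Negative A := by
  induction A with
  | bot => simpa using fun h : Affirmative bot => by cases h
  | top => simpa using Affirmative.top
  | rhd A B => simpa using Affirmative.rhd A B
  | box A => simpa using Affirmative.box A
  | imp A B hA hB =>
    rw [negative_imp_iff_aux, hA]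
    constructor
    · intro h
      cases h with
      | imp_left _ _ h => tauto
      | imp_right _ _ h => tauto
    · intro h
      by_cases hN : Negative A
      · exact .imp_left _ _ hN
      · exact .imp_right _ _ (hB.2 (by tauto))

@[simp] theorem negative_imp_iff (A B : Formula) :
    Negative (imp A B) ↔ ¬ Negative A ∧ Negative B := by
  rw [negative_imp_iff_aux, affirmative_iff]

@[simp] theorem not_direct_bot : ¬ Direct bot := fun h => by cases h
@[simp] theorem not_direct_top : ¬ Direct top := fun h => by cases h
@[simp] theorem not_direct_imp (A B : Formula) : ¬ Direct (imp A B) := fun h => by cases h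
@[simp] theorem direct_box_iff (A : Formula) : Direct (box A) ↔ Negative A :=
  ⟨fun h => by cases h with | box _ h => exact h, .box A⟩
@[simp] theorem direct_rhd_iff (A B : Formula) :
    Direct (rhd A B) ↔ ¬ Negative A ∧ Negative B := by
  rw [← affirmative_iff]
  exact ⟨fun h => by cases h with | rhd _ _ h h' => exact ⟨h, h'⟩, fun h => .rhd A B h.1 h.2⟩

theorem not_negative_of_direct {A : Formula} (h : Direct A) : ¬ Negative A :=
  (affirmative_iff A).1 (affirmative_of_direct h)

@[simp] theorem not_cross_bot : ¬ Cross bot := fun h => by cases h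
@[simp] theorem not_cross_top : ¬ Cross top := fun h => by cases h
@[simp] theorem not_cross_rhd (A B : Formula) : ¬ Cross (rhd A B) := fun h => by cases h
@[simp] theorem not_cross_box (A : Formula) : ¬ Cross (box A) := fun h => by cases h
@[simp] theorem cross_imp_iff (A B : Formula) : Cross (imp A B) ↔ Direct A ∧ B = bot :=
  ⟨fun h => by cases h with | imp _ h => exact ⟨h, rfl⟩, fun ⟨h, h'⟩ => h' ▸ .imp A h⟩

theorem negative_of_cross {A : Formula} (h : Cross A) : Negative A := by
  cases h with | imp M h => simpa using not_negative_of_direct h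

@[simp] theorem not_basicLocallyGLLike_bot : ¬ BasicLocallyGLLike bot := fun h => by cases h
@[simp] theorem not_basicLocallyGLLike_top : ¬ BasicLocallyGLLike top := fun h => by cases h
@[simp] theorem not_basicLocallyGLLike_imp (A B : Formula) : ¬ BasicLocallyGLLike (imp A B) :=
  fun h => by cases h
@[simp] theorem basicLocallyGLLike_box_iff (A : Formula) :
    BasicLocallyGLLike (box A) ↔ Negative A ∨ Direct A :=
  ⟨fun h => by cases h <;> tauto, fun h => h.elim (.box_negative A) (.box_direct A)⟩
@[simp] theorem basicLocallyGLLike_rhd_iff (A B : Formula) :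
    BasicLocallyGLLike (rhd A B) ↔ A = bot ∨ ¬ Negative B ∨ (¬ Negative A ∧ B = bot) ∨
      (Negative A ∧ Cross B) ∨ (Cross A ∧ B = bot) := by
  rw [← affirmative_iff, ← affirmative_iff]
  constructor
  · intro h
    cases h <;> tauto
  · rintro (rfl | h | ⟨h, rfl⟩ | ⟨h, h'⟩ | ⟨h, rfl⟩)
    · exact .bot_rhd B
    · exact .rhd_affirmative A B h
    · exact .affirmative_rhd_bot A h
    · exact .negative_rhd_cross A B h h'
    · exact .cross_rhd_bot A h

@[simp] theorem locallyGLLike_bot : LocallyGLLike bot := .bot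
@[simp] theorem locallyGLLike_top : LocallyGLLike top := .top
@[simp] theorem locallyGLLike_rhd_iff (A B : Formula) :
    LocallyGLLike (rhd A B) ↔ BasicLocallyGLLike (rhd A B) :=
  ⟨fun h => by cases h with | basic _ h => exact h, .basic _⟩
@[simp] theorem locallyGLLike_box_iff (A : Formula) :
    LocallyGLLike (box A) ↔ BasicLocallyGLLike (box A) :=
  ⟨fun h => by cases h with | basic _ h => exact h, .basic _⟩
@[simp] theorem locallyGLLike_imp_iff (A B : Formula) :
    LocallyGLLike (imp A B) ↔ (LocallyGLLike A ∧ LocallyGLLike B) ∨ B = top := by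
  constructor
  · intro h
    cases h with
    | basic _ h => simp at h
    | imp_top => exact .inr rfl
    | imp _ _ h h' => exact .inl ⟨h, h'⟩
  · rintro (⟨h, h'⟩ | rfl)
    · exact .imp A B h h'
    · exact .imp_top A

@[simp] theorem gllike_top : GLLike top := .locally _ .top

@[simp] theorem gllike_box_iff (A : Formula) : GLLike (box A) ↔ GLLike A := by
  refine ⟨fun h => ?_, .box A⟩
  cases h with
  | locally _ h =>
    simp only [locallyGLLike_box_iff, basicLocallyGLLike_box_iff] at h
    exact h.elim (.negative A) (.direct A)
  | negative _ h => simp at h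
  | direct _ h => exact .negative A (by simpa using h)
  | box _ h => exact h

theorem gllike_rhd_iff (A B : Formula) :
    GLLike (rhd A B) ↔ BasicLocallyGLLike (rhd A B) ∨ (¬ Negative A ∧ Negative B) ∨
      (∃ G, GLLike G ∧ A = imp G bot ∧ B = bot) := by
  constructor
  · intro h
    cases h with
    | locally _ h => exact .inl (by simpa only [locallyGLLike_rhd_iff] using h)
    | negative _ h => simp at h
    | direct _ h => exact .inr (.inl (by simpa using h))
    | rhd G h => exact .inr (.inr ⟨G, h, rfl, rfl⟩)
  · rintro (h | h | ⟨G, h, rfl, rfl⟩)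
    · exact .locally _ (.basic _ h)
    · exact .direct _ (by simpa using h)
    · exact .rhd G h

theorem gllike_imp_iff (A B : Formula) :
    GLLike (imp A B) ↔ LocallyGLLike (imp A B) ∨ Negative (imp A B) ∨ (A = top ∧ GLLike B) := by
  constructor
  · intro h
    cases h with
    | locally _ h => exact .inl h
    | negative _ h => exact .inr (.inl h)
    | direct _ h => simp at h
    | top_imp _ h => exact .inr (.inr ⟨rfl, h⟩)
  · rintro (h | h | ⟨rfl, h⟩)
    · exact .locally _ h
    · exact .negative _ h
    · exact .top_imp B h

/-! ### Generating functions -/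

/-- The generating function of the formulas over `S` with weights `f`. -/
noncomputable def gf (S : Set Symbol) : (Formula → ℝ) →ₗ[ℝ] PowerSeries ℝ where
  toFun f := PowerSeries.mk fun n => ∑ F ∈ (finite_formulas S n).toFinset, f F
  map_add' f g := by ext n; simp [Finset.sum_add_distrib]
  map_smul' c f := by ext n; simp [Finset.mul_sum]

/-- The generating function of the pairs of formulas over `S` with weights `f`. -/
noncomputable def gfPair (S : Set Symbol) : (Formula → Formula → ℝ) →ₗ[ℝ] PowerSeries ℝ where
  toFun f := PowerSeries.mk fun n => ∑ p ∈ Finset.HasAntidiagonal.antidiagonal n,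
    ∑ A ∈ (finite_formulas S p.1).toFinset, ∑ B ∈ (finite_formulas S p.2).toFinset, f A B
  map_add' f g := by ext n; simp [Finset.sum_add_distrib]
  map_smul' c f := by ext n; simp [Finset.mul_sum]

theorem coeff_gf (S : Set Symbol) (f : Formula → ℝ) (n : ℕ) :
    PowerSeries.coeff n (gf S f) = ∑ F ∈ (finite_formulas S n).toFinset, f F := by
  simp [gf]

theorem gfPair_mul (S : Set Symbol) (f g : Formula → ℝ) :
    gfPair S (fun A B => f A * g B) = gf S f * gf S g := by
  ext n
  simp [gfPair, PowerSeries.coeff_mul, coeff_gf, Finset.sum_mul_sum]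

theorem mem_formulas_zero {S : Set Symbol} {F : Formula} :
    F ∈ formulas S 0 ↔ (F = bot ∧ Symbol.bot ∈ S) ∨ (F = top ∧ Symbol.top ∈ S) := by
  cases F <;> simp [formulas, symbols, complexity]

open scoped Classical in
/-- Decomposition of the formulas over an alphabet by their outermost symbol. -/
theorem gf_eq {S : Set Symbol} (hbot : Symbol.bot ∈ S) (himp : Symbol.imp ∈ S)
    (hrhd : Symbol.rhd ∈ S) (f : Formula → ℝ) :
    gf S f = PowerSeries.C (f bot) +
      PowerSeries.C ((if Symbol.top ∈ S then 1 else 0) * f top) +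
      PowerSeries.X * (gfPair S (fun A B => f (imp A B)) + gfPair S (fun A B => f (rhd A B)) +
        PowerSeries.C (if Symbol.box ∈ S then 1 else 0) * gf S (fun A => f (box A))) := by
  ext n
  cases n with
  | zero =>
    have h : (finite_formulas S 0).toFinset = {bot} ∪ (if Symbol.top ∈ S then {top} else ∅) := by
      ext F
      split_ifs with ht <;> simp [mem_formulas_zero, hbot, ht]
    rw [coeff_gf, h, Finset.sum_union (by split_ifs <;> simp)]
    split_ifs <;> simp
  | succ n =>
    have h : (finite_formulas S (n + 1)).toFinset =
        (((Finset.HasAntidiagonal.antidiagonal n).sigma fun p =>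
          (finite_formulas S p.1).toFinset ×ˢ (finite_formulas S p.2).toFinset).image
            fun x => imp x.2.1 x.2.2) ∪
        ((((Finset.HasAntidiagonal.antidiagonal n).sigma fun p =>
          (finite_formulas S p.1).toFinset ×ˢ (finite_formulas S p.2).toFinset).image
            fun x => rhd x.2.1 x.2.2) ∪
        (if Symbol.box ∈ S then (finite_formulas S n).toFinset.image box else ∅)) := by
      ext F
      cases F with
      | bot => split_ifs <;> simp [formulas, complexity]
      | top => split_ifs <;> simp [formulas, complexity]
      | imp A B =>
        split_ifs <;>
        · simp only [formulas, symbols, complexity, Finset.mem_union, Finset.mem_image,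
            Finset.mem_sigma, Finset.mem_product, Set.Finite.mem_toFinset, Set.mem_ofPred_eq,
            Set.union_subset_iff, Set.singleton_subset_iff, himp]
          aesop
      | rhd A B =>
        split_ifs <;>
        · simp only [formulas, symbols, complexity, Finset.mem_union, Finset.mem_image,
            Finset.mem_sigma, Finset.mem_product, Set.Finite.mem_toFinset, Set.mem_ofPred_eq,
            Set.union_subset_iff, Set.singleton_subset_iff, hrhd]
          aesop
      | box A =>
        split_ifs with hbox <;> simp [formulas, symbols, complexity, hbox, Set.insert_subset_iff]
    have hinj (c : Formula → Formula → Formula)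
        (hc : ∀ A B A' B', c A B = c A' B' → A = A' ∧ B = B') :
        ∑ F ∈ ((Finset.HasAntidiagonal.antidiagonal n).sigma fun p =>
          (finite_formulas S p.1).toFinset ×ˢ (finite_formulas S p.2).toFinset).image
            (fun x => c x.2.1 x.2.2), f F =
        PowerSeries.coeff n (gfPair S fun A B => f (c A B)) := by
      rw [Finset.sum_image, Finset.sum_sigma]
      · simp [gfPair, Finset.sum_product]
      · rintro ⟨⟨i, j⟩, A, B⟩ h₁ ⟨⟨i', j'⟩, A', B'⟩ h₂ h
        obtain ⟨rfl, rfl⟩ := hc _ _ _ _ h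
        simp only [Finset.coe_sigma, Set.mem_sigma_iff, Finset.coe_product, Set.mem_prod,
          Finset.mem_coe, Set.Finite.mem_toFinset, formulas, Set.mem_ofPred_eq] at h₁ h₂
        obtain ⟨-, ⟨-, rfl⟩, -, rfl⟩ := h₁
        obtain ⟨-, ⟨-, rfl⟩, -, rfl⟩ := h₂
        rfl
    rw [coeff_gf, h, Finset.sum_union, Finset.sum_union, hinj imp, hinj rhd]
    · rw [map_add, map_add, PowerSeries.coeff_succ_X_mul]
      simp only [PowerSeries.coeff_C, Nat.add_eq_zero_iff, one_ne_zero, and_false, if_false,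
        zero_add, map_add, PowerSeries.coeff_C_mul, coeff_gf]
      split_ifs
      · rw [Finset.sum_image (fun A _ B _ h => by simpa using h)]
        ring
      · simp
    · intro A B A' B'; simp
    · intro A B A' B'; simp
    · rw [Finset.disjoint_left]
      intro F h₁ h₂
      obtain ⟨x, -, rfl⟩ := Finset.mem_image.1 h₁
      split_ifs at h₂ <;> simp at h₂
    · rw [Finset.disjoint_left]
      intro F h₁ h₂
      obtain ⟨x, -, rfl⟩ := Finset.mem_image.1 h₁
      split_ifs at h₂ <;> simp at h₂

end IL

namespace IL

open Formula

/-! ### The equations between the generating functions of the classes -/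

open scoped Classical in
/-- The weight `1` on the formulas with the property `P` and `0` elsewhere. -/
noncomputable def ind (P : Formula → Prop) (F : Formula) : ℝ := if P F then 1 else 0

/-- The formulas `G → ⊥` with `G` affirmative and GL-like but not direct. -/
def NegatedGLLike (F : Formula) : Prop :=
  ∃ G, GLLike G ∧ ¬ Negative G ∧ ¬ Direct G ∧ F = imp G bot

theorem gf_ind_eq_bot {S : Set Symbol} (hbot : Symbol.bot ∈ S) (himp : Symbol.imp ∈ S)
    (hrhd : Symbol.rhd ∈ S) : gf S (ind (· = bot)) = 1 := by
  have h : gfPair S (fun _ _ => 0) = 0 := map_zero (gfPair S)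
  have h' : gf S (fun _ => 0) = 0 := map_zero (gf S)
  rw [gf_eq hbot himp hrhd]
  simp [ind, h, h']

open scoped Classical in
theorem gf_ind_eq_top {S : Set Symbol} (hbot : Symbol.bot ∈ S) (himp : Symbol.imp ∈ S)
    (hrhd : Symbol.rhd ∈ S) :
    gf S (ind (· = top)) = PowerSeries.C (if Symbol.top ∈ S then 1 else 0) := by
  have h : gfPair S (fun _ _ => 0) = 0 := map_zero (gfPair S)
  have h' : gf S (fun _ => 0) = 0 := map_zero (gf S)
  rw [gf_eq hbot himp hrhd]
  simp [ind, h, h']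

/-- The system satisfied by the generating functions `T` of all formulas, `N` of the negative,
`M` of the direct, `X'` of the cross, `B` of the basic locally GL-like, `L` of the locally GL-like
formulas, `P` of the formulas that are locally GL-like and negative, `H` of those that are GL-like
and affirmative, and `Y` of the formulas `G → ⊥` with `G` counted by `H` and not by `M`. The
numbers `τ` and `β` tell whether `⊤` and `□` belong to the alphabet. -/
structure ClassSystem (τ β : ℝ) (T N M X' B L P Y H : PowerSeries ℝ) : Prop where
  total : T = PowerSeries.C (1 + τ) +
    PowerSeries.X * (T * T + T * T + PowerSeries.C β * T)
  negative : N = 1 + PowerSeries.X * ((T - N) * N)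
  direct : M = PowerSeries.X * ((T - N) * N + PowerSeries.C β * N)
  cross : X' = PowerSeries.X * M
  basic : B = PowerSeries.X * (T * (T - N) + N + (T - N) + N * X' + PowerSeries.C β * (N + M))
  locally : L = PowerSeries.C (1 + τ) + B +
    PowerSeries.X * (L * L + PowerSeries.C τ * (T - L))
  locallyNegative : P = 1 + PowerSeries.X * ((L - P) * P)
  negated : Y = PowerSeries.X * (H - M)
  affirmative : H = PowerSeries.C τ + B + PowerSeries.X * ((T - N) * (N - 1) + Y +
    PowerSeries.C β * (H - M) + (L * L + PowerSeries.C τ * (T - L) - (L - P) * P) +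
    PowerSeries.C τ * (H - (L - P)))

open scoped Classical in
theorem classSystem {S : Set Symbol} (hbot : Symbol.bot ∈ S) (himp : Symbol.imp ∈ S)
    (hrhd : Symbol.rhd ∈ S) :
    ClassSystem (if Symbol.top ∈ S then 1 else 0) (if Symbol.box ∈ S then 1 else 0)
      (gf S (ind fun _ => True)) (gf S (ind Negative)) (gf S (ind Direct)) (gf S (ind Cross))
      (gf S (ind BasicLocallyGLLike)) (gf S (ind LocallyGLLike))
      (gf S (ind fun F => LocallyGLLike F ∧ Negative F)) (gf S (ind NegatedGLLike))
      (gf S (ind fun F => GLLike F ∧ ¬ Negative F)) := by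
  have key := @gf_eq S hbot himp hrhd
  have hz := gf_ind_eq_bot hbot himp hrhd
  have ht := gf_ind_eq_top hbot himp hrhd
  set τ : ℝ := if Symbol.top ∈ S then 1 else 0
  set β : ℝ := if Symbol.box ∈ S then 1 else 0
  have hpair {f g : Formula → Formula → ℝ} (h : ∀ A B, f A B = g A B) :
      gfPair S f = gfPair S g := congrArg _ (funext₂ h)
  have hbox {f g : Formula → ℝ} (h : ∀ A, f A = g A) : gf S f = gf S g := congrArg _ (funext h)
  have padd (f g : Formula → Formula → ℝ) :
      gfPair S (fun A B => f A B + g A B) = gfPair S f + gfPair S g := map_add (gfPair S) f g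
  have psub (f g : Formula → Formula → ℝ) :
      gfPair S (fun A B => f A B - g A B) = gfPair S f - gfPair S g := map_sub (gfPair S) f g
  have gadd (f g : Formula → ℝ) : gf S (fun A => f A + g A) = gf S f + gf S g :=
    map_add (gf S) f g
  have gsub (f g : Formula → ℝ) : gf S (fun A => f A - g A) = gf S f - gf S g :=
    map_sub (gf S) f g
  have pzero : gfPair S (fun _ _ => 0) = 0 := map_zero (gfPair S)
  have gzero : gf S (fun _ => 0) = 0 := map_zero (gf S)
  let i := ind fun _ => True
  let z := ind (· = bot)
  let t := ind (· = top)
  let n := ind Negative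
  let m := ind Direct
  let x := ind Cross
  let l := ind LocallyGLLike
  let p := ind fun F => LocallyGLLike F ∧ Negative F
  let y := ind NegatedGLLike
  let h := ind fun F => GLLike F ∧ ¬ Negative F
  have gz : gf S z = 1 := hz
  have gt : gf S t = PowerSeries.C τ := ht
  have himpL (A B : Formula) : ind LocallyGLLike (imp A B) =
      l A * l B + i A * t B - l A * t B := by
    by_cases hB : B = top
    · subst hB; simp [ind, l, i, t]
    · by_cases hA : LocallyGLLike A <;> by_cases hB' : LocallyGLLike B <;>
        simp [ind, l, i, t, hA, hB, hB']
  constructor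
  · nth_rw 1 [key]
    rw [hpair (f := fun A B => ind (fun _ => True) (imp A B)) (g := fun A B => i A * i B)
        (by simp [ind, i]),
      hpair (f := fun A B => ind (fun _ => True) (rhd A B)) (g := fun A B => i A * i B)
        (by simp [ind, i]), hbox (g := i) (by simp [ind, i])]
    simp only [gfPair_mul]
    simp only [ind, if_true, mul_one, map_add, i]
  · nth_rw 1 [key]
    rw [hpair (f := fun A B => ind Negative (imp A B)) (g := fun A B => i A * n B - n A * n B)
        (fun A B => by
          by_cases hA : Negative A <;> by_cases hB : Negative B <;> simp [ind, i, n, hA, hB]),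
      hpair (f := fun A B => ind Negative (rhd A B)) (g := fun A B => 0) (by simp [ind]),
      hbox (g := fun _ => 0) (by simp [ind])]
    simp only [gfPair_mul, psub, pzero, gzero]
    simp only [ind, negative_bot, not_negative_top, if_true, if_false, mul_zero, map_zero, map_one]
    ring
  · nth_rw 1 [key]
    rw [hpair (f := fun A B => ind Direct (imp A B)) (g := fun A B => 0) (by simp [ind]),
      hpair (f := fun A B => ind Direct (rhd A B)) (g := fun A B => i A * n B - n A * n B)
        (fun A B => by
          by_cases hA : Negative A <;> by_cases hB : Negative B <;> simp [ind, i, n, hA, hB]),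
      hbox (g := n) (by simp [ind, n])]
    simp only [gfPair_mul, psub, pzero]
    simp only [ind, not_direct_bot, not_direct_top, if_false, mul_zero, map_zero]
    ring
  · nth_rw 1 [key]
    rw [hpair (f := fun A B => ind Cross (imp A B)) (g := fun A B => m A * z B)
        (fun A B => by
          by_cases hA : Direct A <;> by_cases hB : B = bot <;> simp [ind, m, z, hA, hB]),
      hpair (f := fun A B => ind Cross (rhd A B)) (g := fun A B => 0) (by simp [ind]),
      hbox (g := fun _ => 0) (by simp [ind])]
    simp only [gfPair_mul, pzero, gzero, gz]
    simp only [ind, not_cross_bot, not_cross_top, if_false, mul_zero, map_zero, m]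
    ring
  · nth_rw 1 [key]
    rw [hpair (f := fun A B => ind BasicLocallyGLLike (imp A B)) (g := fun A B => 0)
        (by simp [ind]),
      hpair (f := fun A B => ind BasicLocallyGLLike (rhd A B))
        (g := fun A B => i A * i B - i A * n B + z A * n B + i A * z B - n A * z B + n A * x B
          - z A * x B + x A * z B)
        (fun A B => by
          by_cases hA : A = bot
          · subst hA
            by_cases hB : B = bot
            · subst hB; simp [ind, i, n, z, x]
            · by_cases hN : Negative B <;> by_cases hX : Cross B <;>
                simp [ind, i, n, z, x, hN, hX, hB]
          · by_cases hB : B = bot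
            · subst hB
              by_cases hX : Cross A
              · simp [ind, i, n, z, x, hA, hX, negative_of_cross hX]
              · by_cases hN : Negative A <;> simp [ind, i, n, z, x, hA, hX, hN]
            · by_cases hX : Cross B
              · by_cases hN : Negative A <;>
                  simp [ind, i, n, z, x, hA, hB, hX, hN, negative_of_cross hX]
              · by_cases hN : Negative B <;> simp [ind, i, n, z, x, hA, hB, hX, hN]),
      hbox (g := fun A => n A + m A) (fun A => by
        by_cases hA : Direct A
        · simp [ind, n, m, hA, not_negative_of_direct hA]
        · simp [ind, n, m, hA])]
    simp only [gfPair_mul, padd, psub, gadd, pzero, gz]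
    simp only [ind, not_basicLocallyGLLike_bot, not_basicLocallyGLLike_top, if_false, mul_zero,
      map_zero, i, n, x, m]
    ring
  · nth_rw 1 [key]
    have hB := key (ind BasicLocallyGLLike)
    rw [hpair (f := fun A B => ind BasicLocallyGLLike (imp A B)) (g := fun A B => 0)
        (by simp [ind])] at hB
    rw [hB, hpair himpL,
      hpair (f := fun A B => ind LocallyGLLike (rhd A B))
        (g := fun A B => ind BasicLocallyGLLike (rhd A B)) (by simp [ind]),
      hbox (g := fun A => ind BasicLocallyGLLike (box A)) (by simp [ind])]
    simp only [gfPair_mul, padd, psub, pzero, gt]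
    simp only [ind, locallyGLLike_bot, locallyGLLike_top, not_basicLocallyGLLike_bot,
      not_basicLocallyGLLike_top, if_true, if_false, mul_zero, map_zero, i, l, mul_one, map_add,
      map_one]
    ring
  · nth_rw 1 [key]
    rw [hpair (f := fun A B => ind (fun F => LocallyGLLike F ∧ Negative F) (imp A B))
        (g := fun A B => l A * p B - p A * p B)
        (fun A B => by
          by_cases hB : B = top
          · subst hB; simp [ind, p]
          · by_cases h₁ : LocallyGLLike A <;> by_cases h₂ : Negative A <;>
              by_cases h₃ : LocallyGLLike B <;> by_cases h₄ : Negative B <;>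
              simp [ind, p, l, h₁, h₂, h₃, h₄, hB]),
      hpair (f := fun A B => ind (fun F => LocallyGLLike F ∧ Negative F) (rhd A B))
        (g := fun A B => 0) (by simp [ind]),
      hbox (g := fun _ => 0) (by simp [ind])]
    simp only [gfPair_mul, psub, pzero, gzero]
    simp only [ind, negative_bot, not_negative_top, locallyGLLike_bot, and_self, and_false,
      if_true, if_false, mul_zero, map_zero, map_one, l, p]
    ring
  · nth_rw 1 [key]
    rw [hpair (f := fun A B => ind NegatedGLLike (imp A B))
        (g := fun A B => h A * z B - m A * z B)
        (fun A B => by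
          by_cases hB : B = bot
          · by_cases hm : Direct A
            · simp [ind, NegatedGLLike, h, z, m, hB, hm, not_negative_of_direct hm,
                GLLike.direct A hm]
            · simp [ind, NegatedGLLike, h, z, m, hB, hm]
          · simp [ind, NegatedGLLike, z, hB]),
      hpair (f := fun A B => ind NegatedGLLike (rhd A B)) (g := fun A B => 0)
        (by simp [ind, NegatedGLLike]),
      hbox (g := fun _ => 0) (by simp [ind, NegatedGLLike])]
    simp only [gfPair_mul, psub, pzero, gzero, gz]
    simp only [ind, NegatedGLLike, reduceCtorEq, and_false, exists_false, if_false, mul_zero,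
      map_zero, h, m]
    ring
  · nth_rw 1 [key]
    have hB := key (ind BasicLocallyGLLike)
    rw [hpair (f := fun A B => ind BasicLocallyGLLike (imp A B)) (g := fun A B => 0)
        (by simp [ind])] at hB
    rw [hB, hpair (f := fun A B => ind (fun F => GLLike F ∧ ¬ Negative F) (imp A B))
        (g := fun A B => (l A * l B + i A * t B - l A * t B - (l A * p B - p A * p B)) +
          (t A * h B - t A * l B + t A * p B))
        (fun A B => by
          simp only [ind, gllike_imp_iff, h, l, i, t, p, locallyGLLike_imp_iff, negative_imp_iff]
          by_cases hA : A = top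
          · by_cases hB : B = top
            · simp [hA, hB]
            · by_cases h₃ : LocallyGLLike B <;> by_cases h₄ : Negative B <;>
                by_cases h₅ : GLLike B <;>
                simp [hA, h₃, h₄, h₅, hB] <;> exact h₅ (.locally _ h₃)
          · by_cases hB : B = top
            · simp [hA, hB]
            · by_cases h₁ : LocallyGLLike A <;> by_cases h₂ : Negative A <;>
                by_cases h₃ : LocallyGLLike B <;> by_cases h₄ : Negative B <;>
                simp [h₁, h₂, h₃, h₄, hA, hB]),
      hpair (f := fun A B => ind (fun F => GLLike F ∧ ¬ Negative F) (rhd A B))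
        (g := fun A B => ind BasicLocallyGLLike (rhd A B) +
          (i A * n B - i A * z B - n A * n B + n A * z B) + y A * z B)
        (fun A B => by
          simp only [gllike_rhd_iff, ind, not_negative_rhd, not_false_iff, and_true,
            basicLocallyGLLike_rhd_iff, i, n, z, y, NegatedGLLike]
          by_cases hB : B = bot
          · by_cases hA : A = bot
            · simp [hA, hB]
            · by_cases hN : Negative A
              · by_cases hX : Cross A
                · have : ∀ G, A = imp G bot → Direct G := by
                    rintro G rfl
                    simpa using hX
                  have h₀ : ¬ ∃ G, GLLike G ∧ ¬ Negative G ∧ ¬ Direct G ∧ A = imp G bot :=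
                    fun ⟨G, _, _, h₁, h₂⟩ => h₁ (this G h₂)
                  simp [hA, hB, hN, hX, h₀]
                · have h₀ : (∃ G, GLLike G ∧ ¬ Negative G ∧ ¬ Direct G ∧ A = imp G bot) ↔
                      ∃ G, GLLike G ∧ A = imp G bot := by
                    constructor
                    · rintro ⟨G, h₁, -, -, h₂⟩
                      exact ⟨G, h₁, h₂⟩
                    · rintro ⟨G, h₁, rfl⟩
                      exact ⟨G, h₁, by simpa using hN, by simpa using hX, rfl⟩
                  simp [hA, hB, hN, hX, h₀]
              · have h₀ : ¬ ∃ G, GLLike G ∧ ¬ Negative G ∧ ¬ Direct G ∧ A = imp G bot := by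
                  rintro ⟨G, -, h₁, -, rfl⟩
                  exact hN (by simpa using h₁)
                simp [hA, hB, hN, h₀]
          · by_cases hA : A = bot
            · by_cases h₂ : Negative B <;> simp [hA, hB, h₂]
            · by_cases h₁ : Negative A <;> by_cases h₂ : Negative B <;> simp [hA, hB, h₁, h₂]),
      hbox (g := fun A => ind BasicLocallyGLLike (box A) + (h A - m A))
        (fun A => by
          simp only [ind, gllike_box_iff, basicLocallyGLLike_box_iff, not_negative_box,
            not_false_iff, and_true, h, m]
          by_cases hm : Direct A
          · simp [hm, GLLike.direct A hm, not_negative_of_direct hm]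
          · by_cases hn : Negative A
            · simp [hm, hn, GLLike.negative A hn]
            · simp [hm, hn])]
    simp only [gfPair_mul, padd, psub, gadd, gsub, pzero, gz, gt]
    simp only [ind, not_basicLocallyGLLike_bot, not_basicLocallyGLLike_top, gllike_top,
      negative_bot, not_negative_top, not_true, not_false_iff, and_self, and_false,
      if_true, if_false, mul_zero, mul_one, map_zero, i, n, l, p, h, m, y]
    ring

end IL

namespace IL

open Filter Topology Finset

/-! ### Approximate limits -/

/-- The upper limit of `|u n - a|` is at most `δ`. -/
def Approx (u : ℕ → ℝ) (a δ : ℝ) : Prop := ∀ ε > 0, ∀ᶠ n in atTop, |u n - a| ≤ δ + ε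

namespace Approx

variable {u v : ℕ → ℝ} {a b δ η : ℝ}

theorem congr' (h : Approx u a δ) (huv : u =ᶠ[atTop] v) : Approx v a δ := fun ε hε => by
  filter_upwards [h ε hε, huv] with n hn h'
  rwa [← h']

theorem of_tendsto (h : Tendsto u atTop (𝓝 a)) : Approx u a 0 := fun ε hε => by
  filter_upwards [Metric.tendsto_nhds.1 h ε hε] with n hn
  rw [Real.dist_eq] at hn
  linarith

theorem tendsto (h : Approx u a 0) : Tendsto u atTop (𝓝 a) := by
  refine Metric.tendsto_nhds.2 fun ε hε => ?_
  filter_upwards [h (ε / 2) (by linarith)] with n hn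
  rw [Real.dist_eq]
  linarith

theorem mono (h : Approx u a δ) (hδ : δ ≤ η) : Approx u a η := fun ε hε => by
  filter_upwards [h ε hε] with n hn
  linarith

theorem add (hu : Approx u a δ) (hv : Approx v b η) :
    Approx (fun n => u n + v n) (a + b) (δ + η) := fun ε hε => by
  filter_upwards [hu (ε / 2) (by linarith), hv (ε / 2) (by linarith)] with n h₁ h₂
  calc |u n + v n - (a + b)| = |(u n - a) + (v n - b)| := by congr 1; ring
    _ ≤ |u n - a| + |v n - b| := abs_add_le _ _
    _ ≤ _ := by linarith

theorem sum {ι : Type*} (s : Finset ι) {u : ι → ℕ → ℝ} {a δ : ι → ℝ}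
    (h : ∀ i ∈ s, Approx (u i) (a i) (δ i)) :
    Approx (fun n => ∑ i ∈ s, u i n) (∑ i ∈ s, a i) (∑ i ∈ s, δ i) := by
  classical
  induction s using Finset.induction_on with
  | empty => simpa using of_tendsto tendsto_const_nhds
  | insert i s hi ih =>
    simp only [Finset.sum_insert hi]
    exact (h i (mem_insert_self i s)).add (ih fun j hj => h j (mem_insert_of_mem hj))

theorem mul_tendsto {c : ℝ} (hu : Approx u a δ) (hv : Tendsto v atTop (𝓝 c)) :
    Approx (fun n => u n * v n) (a * c) (δ * |c|) := fun ε hε => by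
  set κ := ε / (2 * (|c| + 1)) with hκ
  have hc : 0 < |c| + 1 := by positivity
  have hκ0 : 0 < κ := by positivity
  have hlim : Tendsto (fun n => (δ + κ) * |v n| + |a| * |v n - c|) atTop
      (𝓝 ((δ + κ) * |c| + |a| * |c - c|)) :=
    (hv.abs.const_mul _).add ((hv.sub_const c).abs.const_mul _)
  have hlt : (δ + κ) * |c| + |a| * |c - c| < δ * |c| + ε := by
    have h : κ * (|c| + 1) = ε / 2 := by rw [hκ]; field_simp
    rw [sub_self, abs_zero, mul_zero, add_zero]
    nlinarith
  filter_upwards [hu κ hκ0, hlim.eventually (gt_mem_nhds hlt)] with n h₁ h₂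
  calc |u n * v n - a * c| = |(u n - a) * v n + a * (v n - c)| := by congr 1; ring
    _ ≤ |(u n - a) * v n| + |a * (v n - c)| := abs_add_le _ _
    _ = |u n - a| * |v n| + |a| * |v n - c| := by rw [abs_mul, abs_mul]
    _ ≤ (δ + κ) * |v n| + |a| * |v n - c| := by gcongr
    _ ≤ _ := h₂.le

theorem const_mul (c : ℝ) (hu : Approx u a δ) :
    Approx (fun n => c * u n) (c * a) (|c| * δ) := by
  simpa only [mul_comm] using hu.mul_tendsto (tendsto_const_nhds (x := c))

theorem comp_sub (hu : Approx u a δ) (k : ℕ) : Approx (fun n => u (n - k)) a δ := fun ε hε =>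
  (tendsto_sub_atTop_nat k).eventually (hu ε hε)

/-- An approximate limit can be determined up to arbitrarily small errors. -/
theorem of_forall_close
    (h : ∀ ε > 0, ∃ v b, Approx v b δ ∧ (∀ᶠ n in atTop, |u n - v n| ≤ ε) ∧ |b - a| ≤ ε) :
    Approx u a δ := fun ε hε => by
  obtain ⟨v, b, h₁, h₂, h₃⟩ := h (ε / 3) (by linarith)
  filter_upwards [h₁ (ε / 3) (by linarith), h₂] with n h₄ h₅
  calc |u n - a| = |(u n - v n) + (v n - b) + (b - a)| := by congr 1; ring
    _ ≤ |u n - v n| + |v n - b| + |b - a| := abs_add_three _ _ _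
    _ ≤ _ := by linarith

end Approx

/-! ### Convolutions of sequences comparable to a subcritical sequence -/

theorem sum_range_split (φ : ℕ → ℝ) {K n : ℕ} (h : 2 * K ≤ n + 1) :
    ∑ k ∈ range (n + 1), φ k = ∑ k ∈ range K, φ k + ∑ k ∈ range K, φ (n - k) +
      ∑ k ∈ Ico K (n + 1 - K), φ k := by
  have h₁ : ∑ k ∈ Ico (n + 1 - K) (n + 1), φ k = ∑ k ∈ range K, φ (n - k) := by
    rw [Finset.range_eq_Ico, Finset.sum_Ico_reflect φ 0 (by omega : K ≤ n + 1)]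
    simp
  rw [← h₁, Finset.range_eq_Ico, Finset.range_eq_Ico,
    ← Finset.sum_Ico_consecutive φ (Nat.zero_le (n + 1 - K)) (by omega : n + 1 - K ≤ n + 1),
    ← Finset.sum_Ico_consecutive φ (Nat.zero_le K) (by omega : K ≤ n + 1 - K)]
  ring

/-- A positive sequence whose ratios tend to `ρ⁻¹`, whose generating function takes the value `V`
at `ρ`, and whose convolution square is asymptotic to `2 V` times the sequence. -/
structure Subcritical (t : ℕ → ℝ) (ρ V : ℝ) : Prop where
  pos : ∀ n, 0 < t n
  rho_pos : 0 < ρ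
  ratio : Tendsto (fun n => t n / t (n + 1)) atTop (𝓝 ρ)
  hasSum : HasSum (fun n => t n * ρ ^ n) V
  conv : Tendsto (fun n => (∑ k ∈ range (n + 1), t k * t (n - k)) / t n) atTop (𝓝 (2 * V))

namespace Subcritical

variable {t : ℕ → ℝ} {ρ V : ℝ} {f g : ℕ → ℝ} {a b δ η C : ℝ}

theorem tendsto_shift (ht : Subcritical t ρ V) (k : ℕ) :
    Tendsto (fun n => t (n - k) / t n) atTop (𝓝 (ρ ^ k)) := by
  rw [← tendsto_add_atTop_iff_nat k]
  simp only [Nat.add_sub_cancel]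
  induction k with
  | zero => simpa using tendsto_const_nhds.congr fun n => (div_self (ht.pos n).ne').symm
  | succ k ih =>
    have h := ih.mul ((tendsto_add_atTop_iff_nat k).2 ht.ratio)
    rw [pow_succ]
    refine h.congr fun n => ?_
    have h₁ := (ht.pos (n + k)).ne'
    have h₂ := (ht.pos (n + k + 1)).ne'
    rw [← add_assoc]
    field_simp

theorem approx_shift (ht : Subcritical t ρ V)
    (hf : Approx (fun n => f n / t n) a δ) (k : ℕ) :
    Approx (fun n => f (n - k) / t n) (a * ρ ^ k) (δ * ρ ^ k) := by
  have h := (hf.comp_sub k).mul_tendsto (ht.tendsto_shift k)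
  rw [abs_of_pos (pow_pos ht.rho_pos k)] at h
  refine h.congr' (Eventually.of_forall fun n => ?_)
  have h₁ := (ht.pos (n - k)).ne'
  have h₂ := (ht.pos n).ne'
  simp only
  field_simp

theorem summable (ht : Subcritical t ρ V) (hf : ∀ n, |f n| ≤ C * t n) :
    Summable fun n => |f n| * ρ ^ n := by
  refine Summable.of_nonneg_of_le (fun n => ?_) (fun n => ?_) (ht.hasSum.summable.mul_left C)
  · have := ht.rho_pos
    positivity
  · rw [← mul_assoc]
    exact mul_le_mul_of_nonneg_right (hf n) (pow_pos ht.rho_pos n).le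

theorem summable' (ht : Subcritical t ρ V) (hf : ∀ n, |f n| ≤ C * t n) :
    Summable fun n => f n * ρ ^ n := by
  refine Summable.of_abs ((ht.summable hf).congr fun n => ?_)
  rw [abs_mul, abs_of_pos (pow_pos ht.rho_pos n)]

theorem approx_conv (ht : Subcritical t ρ V) (hf : ∀ n, |f n| ≤ C * t n)
    (hg : ∀ n, |g n| ≤ C * t n) (hδ : 0 ≤ δ) (hη : 0 ≤ η)
    (hfa : Approx (fun n => f n / t n) a δ) (hgb : Approx (fun n => g n / t n) b η) :
    Approx (fun n => (∑ k ∈ range (n + 1), f k * g (n - k)) / t n)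
      (b * (∑' n, f n * ρ ^ n) + a * ∑' n, g n * ρ ^ n)
      (η * (∑' n, |f n| * ρ ^ n) + δ * ∑' n, |g n| * ρ ^ n) := by
  have hρ := ht.rho_pos
  have hC : 0 ≤ C := by
    have h := (abs_nonneg _).trans (hf 0)
    exact nonneg_of_mul_nonneg_left h (ht.pos 0)
  have head {f g : ℕ → ℝ} {b η : ℝ} (hη : 0 ≤ η) (hf : ∀ n, |f n| ≤ C * t n)
      (hgb : Approx (fun n => g n / t n) b η) (K : ℕ) :
      Approx (fun n => (∑ k ∈ range K, f k * g (n - k)) / t n)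
        (b * ∑ k ∈ range K, f k * ρ ^ k) (η * ∑' n, |f n| * ρ ^ n) := by
    have h := Approx.sum (range K) fun k _ =>
      (ht.approx_shift hgb k).const_mul (f k)
    have h₁ : ∑ k ∈ range K, |f k| * (η * ρ ^ k) ≤ η * ∑' n, |f n| * ρ ^ n := by
      rw [show ∑ k ∈ range K, |f k| * (η * ρ ^ k) = η * ∑ k ∈ range K, |f k| * ρ ^ k by
        rw [Finset.mul_sum]; exact Finset.sum_congr rfl fun _ _ => by ring]
      gcongr
      exact (ht.summable hf).sum_le_tsum _ fun k _ => by positivity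
    have h₂ : ∑ k ∈ range K, f k * (b * ρ ^ k) = b * ∑ k ∈ range K, f k * ρ ^ k := by
      rw [Finset.mul_sum]; exact Finset.sum_congr rfl fun _ _ => by ring
    rw [h₂] at h
    refine (h.mono h₁).congr' (Eventually.of_forall fun n => ?_)
    simp only [Finset.sum_div, mul_div_assoc]
  refine Approx.of_forall_close fun ε hε => ?_
  have hVK := ht.hasSum.tendsto_sum_nat
  have hFK := (ht.summable' hf).hasSum.tendsto_sum_nat
  have hGK := (ht.summable' hg).hasSum.tendsto_sum_nat
  have h₁ : Tendsto (fun K => C ^ 2 * (2 * V - 2 * ∑ k ∈ range K, t k * ρ ^ k)) atTop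
      (𝓝 (C ^ 2 * (2 * V - 2 * V))) := (((hVK.const_mul 2).const_sub _).const_mul _)
  rw [sub_self, mul_zero] at h₁
  have h₂ := (hFK.const_mul b).add (hGK.const_mul a)
  obtain ⟨K, hK₁, hK₂⟩ := ((h₁.eventually (gt_mem_nhds hε)).and
    (Metric.tendsto_nhds.1 h₂ ε hε)).exists
  refine ⟨fun n => (∑ k ∈ range K, f k * g (n - k)) / t n + (∑ k ∈ range K, g k * f (n - k)) / t n,
    _, (head hη hf hgb K).add (head hδ hg hfa K), ?_, ?_⟩
  · have h₃ : Tendsto (fun n => C ^ 2 * ((∑ k ∈ range (n + 1), t k * t (n - k)) / t n -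
        2 * ((∑ k ∈ range K, t k * t (n - k)) / t n))) atTop
        (𝓝 (C ^ 2 * (2 * V - 2 * ∑ k ∈ range K, t k * ρ ^ k))) := by
      refine (ht.conv.sub (Tendsto.const_mul 2 ?_)).const_mul _
      simp only [Finset.sum_div, mul_div_assoc]
      exact tendsto_finsetSum _ fun k _ => (ht.tendsto_shift k).const_mul _
    filter_upwards [h₃.eventually (gt_mem_nhds hK₁), eventually_ge_atTop (2 * K)] with n hn hKn
    refine le_trans ?_ hn.le
    have htn := ht.pos n
    rw [sum_range_split (fun k => f k * g (n - k)) (K := K) (by omega),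
      sum_range_split (fun k => t k * t (n - k)) (K := K) (by omega)]
    have hrefl (f g : ℕ → ℝ) : ∑ k ∈ range K, f (n - k) * g (n - (n - k)) =
        ∑ k ∈ range K, g k * f (n - k) := Finset.sum_congr rfl fun k hk => by
      rw [Nat.sub_sub_self (by have := mem_range.1 hk; omega), mul_comm]
    simp only [hrefl]
    rw [show ∀ x y z : ℝ, (x + y + z) / t n - (x / t n + y / t n) = z / t n by
        intro x y z; ring,
      show ∀ x z : ℝ, (x + x + z) / t n - 2 * (x / t n) = z / t n by intro x z; ring,
      abs_div, abs_of_pos htn, ← mul_div_assoc]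
    gcongr
    rw [Finset.mul_sum]
    refine (Finset.abs_sum_le_sum_abs _ _).trans (Finset.sum_le_sum fun k _ => ?_)
    rw [abs_mul]
    calc |f k| * |g (n - k)| ≤ (C * t k) * (C * t (n - k)) :=
          mul_le_mul (hf k) (hg _) (abs_nonneg _) (mul_nonneg hC (ht.pos k).le)
      _ = _ := by ring
  · rw [← Real.dist_eq]
    exact hK₂.le

end Subcritical

end IL

namespace IL

open Filter Topology Finset

/-! ### Values and limit ratios of power series -/

/-- The power series `f` takes the value `v` at `ρ`, and its coefficients are asymptotic to `a`
times those of the reference sequence `t`. -/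
structure HasAsymptotics (t : ℕ → ℝ) (ρ : ℝ) (f : PowerSeries ℝ) (v a : ℝ) : Prop where
  hasSum : HasSum (fun n => PowerSeries.coeff n f * ρ ^ n) v
  tendsto : Tendsto (fun n => PowerSeries.coeff n f / t n) atTop (𝓝 a)

theorem coeff_mul_range (f g : PowerSeries ℝ) (n : ℕ) : PowerSeries.coeff n (f * g) =
    ∑ k ∈ range (n + 1), PowerSeries.coeff k f * PowerSeries.coeff (n - k) g := by
  rw [PowerSeries.coeff_mul,
    Finset.Nat.sum_antidiagonal_eq_sum_range_succ
      (fun i j => PowerSeries.coeff i f * PowerSeries.coeff j g)]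

theorem hasSum_coeff_mul {f g : PowerSeries ℝ} {ρ : ℝ}
    (hf : Summable fun n => ‖PowerSeries.coeff n f * ρ ^ n‖)
    (hg : Summable fun n => ‖PowerSeries.coeff n g * ρ ^ n‖) :
    HasSum (fun n => PowerSeries.coeff n (f * g) * ρ ^ n)
      ((∑' n, PowerSeries.coeff n f * ρ ^ n) * ∑' n, PowerSeries.coeff n g * ρ ^ n) := by
  have hs := summable_norm_sum_mul_range_of_summable_norm hf hg
  rw [tsum_mul_tsum_eq_tsum_sum_range_of_summable_norm hf hg]
  refine hs.of_norm.hasSum.congr_fun fun n => ?_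
  rw [coeff_mul_range, Finset.sum_mul]
  refine Finset.sum_congr rfl fun k hk => ?_
  have h : ρ ^ n = ρ ^ k * ρ ^ (n - k) := by
    rw [← pow_add, Nat.add_sub_cancel' (by have := mem_range.1 hk; omega)]
  rw [h]
  ring

namespace HasAsymptotics

variable {t : ℕ → ℝ} {ρ V : ℝ} {f g h : PowerSeries ℝ} {v w a b : ℝ}

theorem const (c : ℝ) : HasAsymptotics t ρ (PowerSeries.C c) c 0 where
  hasSum := by
    have h := hasSum_single (f := fun n => PowerSeries.coeff n (PowerSeries.C c) * ρ ^ n) 0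
      fun n hn => by simp [PowerSeries.coeff_C, hn]
    simpa using h
  tendsto := by
    refine tendsto_const_nhds.congr' ?_
    filter_upwards [eventually_ne_atTop 0] with n hn
    simp [PowerSeries.coeff_C, hn]

theorem one : HasAsymptotics t ρ 1 1 0 := by simpa using const (t := t) (ρ := ρ) 1

theorem add (hf : HasAsymptotics t ρ f v a) (hg : HasAsymptotics t ρ g w b) :
    HasAsymptotics t ρ (f + g) (v + w) (a + b) where
  hasSum := by simpa [add_mul] using hf.hasSum.add hg.hasSum
  tendsto := by simpa [add_div] using hf.tendsto.add hg.tendsto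

theorem sub (hf : HasAsymptotics t ρ f v a) (hg : HasAsymptotics t ρ g w b) :
    HasAsymptotics t ρ (f - g) (v - w) (a - b) where
  hasSum := by simpa [sub_mul] using hf.hasSum.sub hg.hasSum
  tendsto := by simpa [sub_div] using hf.tendsto.sub hg.tendsto

theorem const_mul (c : ℝ) (hf : HasAsymptotics t ρ f v a) :
    HasAsymptotics t ρ (PowerSeries.C c * f) (c * v) (c * a) where
  hasSum := by simpa [mul_assoc] using hf.hasSum.mul_left c
  tendsto := by simpa [mul_div_assoc] using hf.tendsto.const_mul c

theorem X_mul (ht : Subcritical t ρ V) (hf : HasAsymptotics t ρ f v a) :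
    HasAsymptotics t ρ (PowerSeries.X * f) (ρ * v) (ρ * a) where
  hasSum := by
    rw [← hasSum_nat_add_iff' 1]
    have h := hf.hasSum.mul_left ρ
    simp only [PowerSeries.coeff_succ_X_mul, pow_succ, range_one, sum_singleton,
      PowerSeries.coeff_zero_X_mul, zero_mul, sub_zero]
    exact h.congr_fun fun n => by ring
  tendsto := by
    rw [← tendsto_add_atTop_iff_nat 1, mul_comm ρ a]
    refine (hf.tendsto.mul ht.ratio).congr fun n => ?_
    have h₁ := (ht.pos n).ne'
    have h₂ := (ht.pos (n + 1)).ne'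
    rw [PowerSeries.coeff_succ_X_mul]
    field_simp

theorem exists_bound (ht : Subcritical t ρ V) (hf : HasAsymptotics t ρ f v a) :
    ∃ C, ∀ n, |PowerSeries.coeff n f| ≤ C * t n := by
  obtain ⟨C, hC⟩ := hf.tendsto.abs.bddAbove_range
  refine ⟨C, fun n => ?_⟩
  have h := hC ⟨n, rfl⟩
  simp only [abs_div, abs_of_pos (ht.pos n)] at h
  rwa [div_le_iff₀ (ht.pos n)] at h

theorem of_eq (hfg : f = g) (hg : HasAsymptotics t ρ g v a) : HasAsymptotics t ρ f v a := hfg ▸ hg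

theorem unique (hf : HasAsymptotics t ρ f v a) (hfg : f = g) (hg : HasAsymptotics t ρ g w b) :
    v = w ∧ a = b := by
  subst hfg
  exact ⟨hf.hasSum.unique hg.hasSum, tendsto_nhds_unique hf.tendsto hg.tendsto⟩

theorem mul (ht : Subcritical t ρ V) (hf : HasAsymptotics t ρ f v a)
    (hg : HasAsymptotics t ρ g w b) :
    HasAsymptotics t ρ (f * g) (v * w) (a * w + v * b) := by
  obtain ⟨C₁, h₁⟩ := hf.exists_bound ht
  obtain ⟨C₂, h₂⟩ := hg.exists_bound ht
  have hle₁ : ∀ n, |PowerSeries.coeff n f| ≤ max C₁ C₂ * t n := fun n =>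
    (h₁ n).trans (mul_le_mul_of_nonneg_right (le_max_left _ _) (ht.pos n).le)
  have hle₂ : ∀ n, |PowerSeries.coeff n g| ≤ max C₁ C₂ * t n := fun n =>
    (h₂ n).trans (mul_le_mul_of_nonneg_right (le_max_right _ _) (ht.pos n).le)
  have hnorm {f : PowerSeries ℝ} {C : ℝ} (h : ∀ n, |PowerSeries.coeff n f| ≤ C * t n) :
      Summable fun n => ‖PowerSeries.coeff n f * ρ ^ n‖ :=
    (ht.summable h).congr fun n => by
      rw [Real.norm_eq_abs, abs_mul, abs_of_pos (pow_pos ht.rho_pos n)]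
  constructor
  · have h := hasSum_coeff_mul (hnorm h₁) (hnorm h₂)
    rwa [hf.hasSum.tsum_eq, hg.hasSum.tsum_eq] at h
  · have h := (ht.approx_conv hle₁ hle₂ le_rfl le_rfl (Approx.of_tendsto hf.tendsto)
      (Approx.of_tendsto hg.tendsto))
    rw [hf.hasSum.tsum_eq, hg.hasSum.tsum_eq, zero_mul, zero_mul, add_zero] at h
    simp only [← coeff_mul_range] at h
    have h' := h.tendsto
    rwa [add_comm, mul_comm b] at h'

theorem approx_X_mul (ht : Subcritical t ρ V) {δ : ℝ}
    (h : Approx (fun n => PowerSeries.coeff n f / t n) a δ) :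
    Approx (fun n => PowerSeries.coeff n (PowerSeries.X * f) / t n) (a * ρ) (δ * ρ) := by
  have h₁ := ht.approx_shift h 1
  rw [pow_one] at h₁
  refine h₁.congr' ?_
  filter_upwards [eventually_ge_atTop 1] with n hn
  obtain ⟨m, rfl⟩ := Nat.exists_eq_add_of_le' hn
  rw [PowerSeries.coeff_succ_X_mul, Nat.add_sub_cancel]

/-- A power series that is dominated by the reference sequence and satisfies a quadratic equation
with subcritical coefficients has a limit ratio. -/
theorem exists_of_quadratic (ht : Subcritical t ρ V) {κ : ℝ}
    (hf : ∀ n, |PowerSeries.coeff n f| ≤ t n)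
    (hg : HasAsymptotics t ρ g w b) {u c : ℝ} (hh : HasAsymptotics t ρ h u c)
    (heq : f = g + PowerSeries.X * (h * f) + PowerSeries.C κ * (PowerSeries.X * (f * f)))
    (hq : ρ * ((∑' n, |PowerSeries.coeff n h| * ρ ^ n) + 2 * |κ| * V) < 1) :
    ∃ v a, HasAsymptotics t ρ f v a ∧ |v| ≤ V := by
  have hρ := ht.rho_pos
  obtain ⟨C₁, h₁⟩ := hh.exists_bound ht
  have hle₁ : ∀ n, |PowerSeries.coeff n h| ≤ max C₁ 1 * t n := fun n =>
    (h₁ n).trans (mul_le_mul_of_nonneg_right (le_max_left _ _) (ht.pos n).le)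
  have hle₂ : ∀ n, |PowerSeries.coeff n f| ≤ max C₁ 1 * t n := fun n =>
    (hf n).trans (by
      nth_rw 1 [← one_mul (t n)]
      exact mul_le_mul_of_nonneg_right (le_max_right _ _) (ht.pos n).le)
  set Q := ∑' n, |PowerSeries.coeff n h| * ρ ^ n with hQ
  set W := ∑' n, |PowerSeries.coeff n f| * ρ ^ n with hW
  set v := ∑' n, PowerSeries.coeff n f * ρ ^ n with hv
  have habs {f : PowerSeries ℝ} {C : ℝ} (h : ∀ n, |PowerSeries.coeff n f| ≤ C * t n) :
      |∑' n, PowerSeries.coeff n f * ρ ^ n| ≤ ∑' n, |PowerSeries.coeff n f| * ρ ^ n := by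
    have hs : Summable fun n => ‖PowerSeries.coeff n f * ρ ^ n‖ :=
      (ht.summable h).congr fun n => by
        rw [Real.norm_eq_abs, abs_mul, abs_of_pos (pow_pos hρ n)]
    refine (norm_tsum_le_tsum_norm hs).trans_eq (tsum_congr fun n => ?_)
    rw [Real.norm_eq_abs, abs_mul, abs_of_pos (pow_pos hρ n)]
  have hWV : W ≤ V := by
    rw [← ht.hasSum.tsum_eq]
    exact (ht.summable hle₂).tsum_le_tsum
      (fun n => mul_le_mul_of_nonneg_right (hf n) (pow_pos hρ n).le) ht.hasSum.summable
  have hvW : |v| ≤ W := habs hle₂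
  have huQ : |u| ≤ Q := by
    rw [← hh.hasSum.tsum_eq]
    exact habs hle₁
  have hW0 : 0 ≤ W := (abs_nonneg _).trans hvW
  have hQ0 : 0 ≤ Q := (abs_nonneg _).trans huQ
  set q := ρ * (Q + 2 * |κ| * V) with hqdef
  have hq0 : 0 ≤ q := by have := hW0.trans hWV; positivity
  have hden : 0 < 1 - ρ * (u + 2 * κ * v) := by
    have h₂ : ρ * (u + 2 * κ * v) ≤ q := by
      refine mul_le_mul_of_nonneg_left ?_ hρ.le
      have h₃ : κ * v ≤ |κ| * V := (le_abs_self _).trans (by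
        rw [abs_mul]; exact mul_le_mul_of_nonneg_left (hvW.trans hWV) (abs_nonneg _))
      linarith [le_abs_self u]
    linarith
  set a := (b + ρ * (c * v)) / (1 - ρ * (u + 2 * κ * v)) with ha
  have haeq : a = b + (a * u + c * v) * ρ + κ * ((a * v + a * v) * ρ) := by
    have := div_mul_cancel₀ (b + ρ * (c * v)) hden.ne'
    rw [← ha] at this
    linarith
  have step {δ : ℝ} (hδ : 0 ≤ δ) (hfa : Approx (fun n => PowerSeries.coeff n f / t n) a δ) :
      Approx (fun n => PowerSeries.coeff n f / t n) a (q * δ) := by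
    have k₁ := ht.approx_conv hle₁ hle₂ le_rfl hδ (Approx.of_tendsto hh.tendsto) hfa
    have k₂ := ht.approx_conv hle₂ hle₂ hδ hδ hfa hfa
    simp only [← coeff_mul_range] at k₁ k₂
    have k₃ := ((Approx.of_tendsto hg.tendsto).add (approx_X_mul ht k₁)).add
      ((approx_X_mul ht k₂).const_mul κ)
    rw [hh.hasSum.tsum_eq, ← hv, ← haeq, ← hQ, ← hW] at k₃
    refine (k₃.mono ?_).congr' (Eventually.of_forall fun n => ?_)
    · have h₂ : |κ| * W ≤ |κ| * V := mul_le_mul_of_nonneg_left hWV (abs_nonneg _)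
      have h₃ : ρ * δ * (|κ| * W) ≤ ρ * δ * (|κ| * V) := by gcongr
      rw [hqdef]
      linarith
    · conv_rhs => rw [heq]
      simp only [map_add, PowerSeries.coeff_C_mul]
      ring
  have hiter (k : ℕ) : Approx (fun n => PowerSeries.coeff n f / t n) a (q ^ k * (1 + |a|)) := by
    induction k with
    | zero =>
      intro ε hε
      refine Eventually.of_forall fun n => ?_
      have h₂ : |PowerSeries.coeff n f / t n| ≤ 1 := by
        rw [abs_div, abs_of_pos (ht.pos n), div_le_one (ht.pos n)]
        exact hf n
      have h₃ := abs_sub (PowerSeries.coeff n f / t n) a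
      rw [pow_zero]
      linarith
    | succ k ih =>
      rw [pow_succ', mul_assoc]
      exact step (by positivity) ih
  refine ⟨v, a, ⟨(ht.summable' hle₂).hasSum, Approx.tendsto fun ε hε => ?_⟩, hvW.trans hWV⟩
  have hlim : Tendsto (fun k : ℕ => q ^ k * (1 + |a|)) atTop (𝓝 (0 * (1 + |a|))) :=
    (tendsto_pow_atTop_nhds_zero_of_lt_one hq0 hq).mul_const _
  rw [zero_mul] at hlim
  obtain ⟨k, hk⟩ := (hlim.eventually (gt_mem_nhds (half_pos hε))).exists
  filter_upwards [hiter k (ε / 2) (half_pos hε)] with n hn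
  linarith

end HasAsymptotics

end IL

namespace IL

open Filter Topology Finset

/-! ### The number of all formulas -/

theorem tendsto_zero_of_contraction {e ε : ℕ → ℝ} {q B : ℝ} (hq0 : 0 ≤ q) (hq : q < 1)
    (he : ∀ n, 0 ≤ e n) (hB : ∀ n, e n ≤ B) (h : ∀ n, e (n + 1) ≤ q * e n + ε n)
    (hε : Tendsto ε atTop (𝓝 0)) : Tendsto e atTop (𝓝 0) := by
  have hiter (k : ℕ) : Approx e 0 (q ^ k * B) := by
    induction k with
    | zero =>
      intro δ hδ
      refine Eventually.of_forall fun n => ?_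
      rw [sub_zero, abs_of_nonneg (he n), pow_zero, one_mul]
      linarith [hB n]
    | succ k ih =>
      intro δ hδ
      suffices hs : ∀ᶠ n in atTop, |e (n + 1) - 0| ≤ q ^ (k + 1) * B + δ by
        rw [eventually_atTop] at hs ⊢
        obtain ⟨m, hm⟩ := hs
        refine ⟨m + 1, fun n hn => ?_⟩
        obtain ⟨l, rfl⟩ := Nat.exists_eq_add_of_le' (show 1 ≤ n by omega)
        exact hm l (by omega)
      filter_upwards [ih (δ / 2) (half_pos hδ),
        hε.eventually (gt_mem_nhds (half_pos hδ))] with n h₁ h₂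
      rw [sub_zero, abs_of_nonneg (he _)] at h₁ ⊢
      rw [pow_succ']
      nlinarith [h n, mul_le_mul_of_nonneg_left h₁ hq0]
  refine Approx.tendsto fun δ hδ => ?_
  have hlim : Tendsto (fun k : ℕ => q ^ k * B) atTop (𝓝 (0 * B)) :=
    (tendsto_pow_atTop_nhds_zero_of_lt_one hq0 hq).mul_const _
  rw [zero_mul] at hlim
  obtain ⟨k, hk⟩ := (hlim.eventually (gt_mem_nhds (half_pos hδ))).exists
  filter_upwards [hiter k (δ / 2) (half_pos hδ)] with n hn
  linarith

variable {T : PowerSeries ℝ} {α β : ℝ}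

open PowerSeries in
theorem coeff_recurrence (hT : T = C α + X * (T * T + T * T + C β * T)) (n : ℕ) :
    ((n : ℝ) + 4) * coeff (n + 3) T = (β + 4 * α) * (2 * n + 5) * coeff (n + 2) T -
      β ^ 2 * (n + 1) * coeff (n + 1) T := by
  obtain ⟨c, hc⟩ : ∃ c, c = β + 4 * α := ⟨_, rfl⟩
  obtain ⟨d, hd⟩ : ∃ d, d = β ^ 2 := ⟨_, rfl⟩
  rw [← hc, ← hd]
  have h4 : (C 4 : PowerSeries ℝ) = 4 := map_ofNat C 4
  have h2 : (C 2 : PowerSeries ℝ) = 2 := map_ofNat C 2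
  set U : PowerSeries ℝ := 1 - C β * X - C 4 * (X * T) with hU
  set D : PowerSeries ℝ := 1 - C 2 * (C c * X) + C d * (X * X) with hD
  have hUD : U * U = D := by
    rw [hU, hD, hc, hd]
    simp only [map_mul, map_add, map_pow, h4, h2]
    linear_combination (-8 * X) * hT
  have hder : 2 * (U * derivative ℝ U) = derivative ℝ D := by
    rw [← hUD, Derivation.leibniz]
    simp only [smul_eq_mul]
    ring
  have hDU : derivative ℝ D * U = 2 * (D * derivative ℝ U) := by
    rw [← hder, ← hUD]
    ring
  have hD' : derivative ℝ D = C 2 * (C d * X - C c) := by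
    rw [hD]
    simp only [map_add, map_sub, Derivation.leibniz, smul_eq_mul, derivative_X,
      derivative_C, Derivation.map_one_eq_zero, h2]
    rw [← h2, derivative_C, h2]
    ring
  have key : C 2 * (C d * (X * U) - C c * U) = C 2 * (derivative ℝ U -
      C 2 * (C c * (X * derivative ℝ U)) + C d * (X * (X * derivative ℝ U))) := by
    rw [hD', hD] at hDU
    rw [h2] at hDU ⊢
    linear_combination hDU
  have hu (k : ℕ) : coeff (k + 2) U = -4 * coeff (k + 1) T := by
    rw [hU, map_sub, map_sub, coeff_C_mul, coeff_C_mul, coeff_succ_X_mul]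
    simp [coeff_X, coeff_one]
  have h := congrArg (coeff (n + 3)) key
  simp only [map_add, map_sub, coeff_C_mul, coeff_succ_X_mul, coeff_derivative] at h
  rw [hu n, show n + 3 + 1 = n + 2 + 2 by ring, show n + 3 = n + 1 + 2 by ring, hu (n + 1),
    hu (n + 2)] at h
  push_cast at h
  linear_combination (1 / 8) * h

open PowerSeries in
theorem coeff_zero_eq (hT : T = C α + X * (T * T + T * T + C β * T)) : coeff 0 T = α := by
  rw [hT]; simp

open PowerSeries in
theorem coeff_succ_eq (hT : T = C α + X * (T * T + T * T + C β * T)) (n : ℕ) :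
    coeff (n + 1) T = 2 * (∑ k ∈ range (n + 1), coeff k T * coeff (n - k) T) +
      β * coeff n T := by
  nth_rw 1 [hT]
  simp only [map_add, coeff_succ_X_mul, coeff_C_mul, coeff_mul_range, coeff_C, Nat.succ_ne_zero,
    if_false, zero_add]
  ring

open PowerSeries in
theorem coeff_pos (hT : T = C α + X * (T * T + T * T + C β * T)) (hα : 0 < α) (hβ : 0 ≤ β)
    (n : ℕ) : 0 < coeff n T := by
  induction n using Nat.strong_induction_on with
  | _ n ih =>
    cases n with
    | zero => rwa [coeff_zero_eq hT]
    | succ n =>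
      rw [coeff_succ_eq hT]
      have h₁ : 0 < ∑ k ∈ range (n + 1), coeff k T * coeff (n - k) T :=
        Finset.sum_pos (fun k hk => mul_pos (ih k (by have := mem_range.1 hk; omega))
          (ih (n - k) (by omega))) ⟨0, by simp⟩
      have h₂ := mul_nonneg hβ (ih n (by omega)).le
      linarith

open PowerSeries in
theorem two_mul_coeff_le (hT : T = C α + X * (T * T + T * T + C β * T)) (hα : 1 ≤ α)
    (hβ : 0 ≤ β) (n : ℕ) : 2 * coeff n T ≤ coeff (n + 1) T := by
  have hpos := coeff_pos hT (by linarith) hβ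
  rw [coeff_succ_eq hT]
  have h₁ : coeff 0 T * coeff (n - 0) T ≤ ∑ k ∈ range (n + 1), coeff k T * coeff (n - k) T :=
    Finset.single_le_sum (f := fun k => coeff k T * coeff (n - k) T)
      (fun k _ => (mul_pos (hpos k) (hpos _)).le) (by simp)
  rw [coeff_zero_eq hT, Nat.sub_zero] at h₁
  have h₂ := mul_nonneg hβ (hpos n).le
  nlinarith [hpos n]

open PowerSeries in
theorem tendsto_ratio (hT : T = C α + X * (T * T + T * T + C β * T)) (hα : 1 ≤ α)
    (hβ : 0 ≤ β) (hβ1 : β ≤ 1) {ρ : ℝ} (hρ : 0 < ρ) (hρ1 : ρ ≤ 1)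
    (hD : 1 - 2 * (β + 4 * α) * ρ + β ^ 2 * ρ ^ 2 = 0) :
    Tendsto (fun n => coeff (n + 1) T / coeff n T) atTop (𝓝 ρ⁻¹) := by
  have hpos := coeff_pos hT (by linarith) hβ
  set c := β + 4 * α with hc
  set r : ℕ → ℝ := fun n => coeff (n + 1) T / coeff n T with hr
  have hr2 (n : ℕ) : 2 ≤ r n := by
    rw [hr, le_div_iff₀ (hpos n)]
    exact two_mul_coeff_le hT hα hβ n
  have hrec (n : ℕ) : ((n : ℝ) + 4) * r (n + 2) = c * (2 * n + 5) -
      β ^ 2 * (n + 1) * (r (n + 1))⁻¹ := by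
    have h := coeff_recurrence hT n
    have h₁ := (hpos (n + 1)).ne'
    have h₂ := (hpos (n + 2)).ne'
    simp only [hr, inv_div]
    rw [← hc] at h
    field_simp
    linear_combination h
  have hle (n : ℕ) : r (n + 2) ≤ 2 * c := by
    have h := hrec n
    have h₁ : 0 ≤ β ^ 2 * (n + 1) * (r (n + 1))⁻¹ := by
      have := hr2 (n + 1)
      positivity
    have hn : (0 : ℝ) ≤ n := n.cast_nonneg
    have hc0 : 0 ≤ c := by linarith
    by_contra hlt
    push Not at hlt
    nlinarith
  have hstep (n : ℕ) : |r (n + 2) - ρ⁻¹| ≤ 1 / 2 * |r (n + 1) - ρ⁻¹| +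
      (3 * c + 3) * ((n : ℝ) + 4)⁻¹ := by
    have hn : (0 : ℝ) < n + 4 := by positivity
    have hn1 : (0 : ℝ) < n + 1 := by positivity
    have hr0 : 0 < r (n + 1) := by linarith [hr2 (n + 1)]
    have hfix : ρ⁻¹ = 2 * c - β ^ 2 * ρ := by
      field_simp
      linear_combination hD
    have e : r (n + 2) - ρ⁻¹ = (β ^ 2 * ρ * ((n + 1) / (n + 4))) * (r (n + 1))⁻¹ *
        (r (n + 1) - ρ⁻¹) + (3 * β ^ 2 * ρ - 3 * c) * ((n : ℝ) + 4)⁻¹ := by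
      have h := hrec n
      have h₁ : r (n + 2) = (c * (2 * n + 5) - β ^ 2 * (n + 1) * (r (n + 1))⁻¹) / (n + 4) := by
        rw [← h]; field_simp
      have h₂ : (r (n + 1))⁻¹ * (r (n + 1) - ρ⁻¹) * ρ = ρ - (r (n + 1))⁻¹ := by
        field_simp
      rw [show β ^ 2 * ρ * (((n : ℝ) + 1) / (n + 4)) * (r (n + 1))⁻¹ * (r (n + 1) - ρ⁻¹) =
        β ^ 2 * (((n : ℝ) + 1) / (n + 4)) * ((r (n + 1))⁻¹ * (r (n + 1) - ρ⁻¹) * ρ) by ring, h₂,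
        h₁, hfix]
      field_simp
      ring
    rw [e]
    refine (abs_add_le _ _).trans (add_le_add ?_ ?_)
    · rw [abs_mul]
      refine mul_le_mul_of_nonneg_right ?_ (abs_nonneg _)
      rw [abs_of_nonneg (by positivity)]
      have h₁ : (r (n + 1))⁻¹ ≤ 1 / 2 := by
        rw [inv_le_comm₀ hr0 (by norm_num)]
        simpa using hr2 (n + 1)
      have h₂ : ((n : ℝ) + 1) / (n + 4) ≤ 1 := by
        rw [div_le_one hn]; linarith
      have h₃ : β ^ 2 ≤ 1 := pow_le_one₀ hβ hβ1
      calc β ^ 2 * ρ * (((n : ℝ) + 1) / (n + 4)) * (r (n + 1))⁻¹ ≤ 1 * 1 * 1 * (1 / 2) := by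
            gcongr
        _ = 1 / 2 := by norm_num
    · rw [abs_mul, abs_of_pos (inv_pos.2 hn)]
      refine mul_le_mul_of_nonneg_right ?_ (inv_pos.2 hn).le
      have h₃ : β ^ 2 * ρ ≤ 1 := mul_le_one₀ (pow_le_one₀ hβ hβ1) hρ.le hρ1
      have h₄ : 0 ≤ β ^ 2 * ρ := by positivity
      rw [abs_le]
      constructor <;> linarith
  have hlim := tendsto_zero_of_contraction (e := fun n => |r (n + 1 + 1) - ρ⁻¹|)
    (ε := fun n => (3 * c + 3) * (((n + 1 : ℕ) : ℝ) + 4)⁻¹) (B := 2 * c + |ρ⁻¹|)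
    (by norm_num) (by norm_num) (fun n => abs_nonneg _)
    (fun n => by
      refine (abs_sub _ _).trans (add_le_add ?_ le_rfl)
      rw [abs_of_pos (by linarith [hr2 (n + 1 + 1)])]
      exact hle n)
    (fun n => hstep (n + 1)) (by
      rw [← mul_zero (3 * c + 3)]
      refine Tendsto.const_mul _ (tendsto_inv_atTop_zero.comp ?_)
      exact tendsto_atTop_add_const_right _ _
        (tendsto_natCast_atTop_atTop.comp (tendsto_add_atTop_nat 1)))
  rw [← tendsto_add_atTop_iff_nat 2]
  rw [tendsto_iff_norm_sub_tendsto_zero]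
  exact hlim

open PowerSeries in
/-- The singular behaviour of the generating function of all formulas. -/
theorem subcritical_total (hT : T = C α + X * (T * T + T * T + C β * T)) (hα : 1 ≤ α)
    (hβ : 0 ≤ β) (hβ1 : β ≤ 1) {ρ : ℝ} (hρ : 0 < ρ) (hρ1 : ρ ≤ 1)
    (hD : 1 - 2 * (β + 4 * α) * ρ + β ^ 2 * ρ ^ 2 = 0) :
    Subcritical (fun n => coeff n T) ρ ((1 - β * ρ) / (4 * ρ)) := by
  have hpos := coeff_pos hT (by linarith) hβ
  have hr := tendsto_ratio hT hα hβ hβ1 hρ hρ1 hD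
  set V := (1 - β * ρ) / (4 * ρ) with hV
  have hV4 : 4 * ρ * V = 1 - β * ρ := by rw [hV]; field_simp
  have hV0 : 0 ≤ V := by
    have : β * ρ ≤ 1 := mul_le_one₀ hβ1 hρ.le hρ1
    exact div_nonneg (by linarith) (by linarith)
  have hVα : α = 2 * ρ * V ^ 2 := by
    have h : 8 * ρ * α = 8 * ρ * (2 * ρ * V ^ 2) := by
      linear_combination (-(4 * ρ * V) - (1 - β * ρ)) * hV4 - hD
    exact mul_left_cancel₀ (by positivity) h
  have hterm (n : ℕ) : 0 ≤ coeff n T * ρ ^ n := mul_nonneg (hpos n).le (pow_pos hρ n).le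
  have hpart (m : ℕ) : ∑ k ∈ range m, coeff k T * ρ ^ k ≤ V := by
    induction m with
    | zero => simpa using hV0
    | succ m ih =>
      set s := ∑ k ∈ range m, coeff k T * ρ ^ k with hs
      have hs0 : 0 ≤ s := Finset.sum_nonneg fun k _ => hterm k
      have hconv : ∑ k ∈ range m, (∑ i ∈ range (k + 1), coeff i T * coeff (k - i) T) * ρ ^ k ≤
          s * s := by
        have h₁ : ∀ k ∈ range m, (∑ i ∈ range (k + 1), coeff i T * coeff (k - i) T) * ρ ^ k =
            ∑ i ∈ range (k + 1), (coeff i T * ρ ^ i) * (coeff (k - i) T * ρ ^ (k - i)) := by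
          intro k _
          rw [Finset.sum_mul]
          refine Finset.sum_congr rfl fun i hi => ?_
          have h : ρ ^ k = ρ ^ i * ρ ^ (k - i) := by
            rw [← pow_add, Nat.add_sub_cancel' (by have := mem_range.1 hi; omega)]
          rw [h]
          ring
        rw [Finset.sum_congr rfl h₁, Finset.sum_range_diag_flip m
          (fun i j => (coeff i T * ρ ^ i) * (coeff j T * ρ ^ j)), hs, Finset.sum_mul_sum]
        refine Finset.sum_le_sum fun i _ => ?_
        exact Finset.sum_le_sum_of_subset_of_nonneg
          (Finset.range_subset_range.2 (by omega)) fun j _ _ => mul_nonneg (hterm i) (hterm j)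
      have hexp : ∑ k ∈ range (m + 1), coeff k T * ρ ^ k = α + ρ * (2 * (∑ k ∈ range m,
          (∑ i ∈ range (k + 1), coeff i T * coeff (k - i) T) * ρ ^ k) + β * s) := by
        rw [Finset.sum_range_succ', coeff_zero_eq hT, hs, Finset.mul_sum, Finset.mul_sum,
          ← Finset.sum_add_distrib, Finset.mul_sum, pow_zero, mul_one, add_comm]
        congr 1
        refine Finset.sum_congr rfl fun k _ => ?_
        rw [coeff_succ_eq hT]
        ring
      have h₂ : s * s ≤ V * V := mul_le_mul ih ih hs0 hV0
      have h₃ : β * s ≤ β * V := mul_le_mul_of_nonneg_left ih hβ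
      have h₄ : ρ * (2 * (∑ k ∈ range m,
          (∑ i ∈ range (k + 1), coeff i T * coeff (k - i) T) * ρ ^ k) + β * s) ≤
          ρ * (2 * (V * V) + β * V) := mul_le_mul_of_nonneg_left (by linarith) hρ.le
      rw [hexp]
      refine (add_le_add le_rfl h₄).trans (le_of_eq ?_)
      linear_combination hVα + V * hV4
  have hsum : Summable fun n => coeff n T * ρ ^ n := summable_of_sum_range_le hterm hpart
  have hval : ∑' n, coeff n T * ρ ^ n = V := by
    set v := ∑' n, coeff n T * ρ ^ n with hv
    have h₁ := hasSum_coeff_mul hsum.norm hsum.norm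
    rw [← hv] at h₁
    have h₂ : HasSum (fun n => coeff (n + 1) T * ρ ^ (n + 1))
        (ρ * (2 * (v * v) + β * v)) := by
      refine (((h₁.mul_left 2).add (hsum.hasSum.mul_left β)).mul_left ρ).congr_fun fun n => ?_
      rw [coeff_succ_eq hT, coeff_mul_range]
      ring
    have h₃ := hsum.hasSum.tsum_eq.symm.trans (hsum.tsum_eq_zero_add)
    rw [h₂.tsum_eq, ← hv, coeff_zero_eq hT, pow_zero, mul_one] at h₃
    have h₄ : 2 * ρ * (v - V) ^ 2 = 0 := by
      linear_combination (-1) * h₃ - hVα - v * hV4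
    have h₅ : (v - V) ^ 2 = 0 := by
      rcases mul_eq_zero.1 h₄ with h | h
      · linarith
      · exact h
    linarith [pow_eq_zero_iff (two_ne_zero) |>.1 h₅]
  refine ⟨hpos, hρ, ?_, hval ▸ hsum.hasSum, ?_⟩
  · have h := hr.inv₀ (inv_pos.2 hρ).ne'
    simpa only [inv_div, inv_inv] using h
  · have h : Tendsto (fun n => (coeff (n + 1) T / coeff n T - β) / 2) atTop
        (𝓝 ((ρ⁻¹ - β) / 2)) := (hr.sub_const β).div_const 2
    rw [show 2 * V = (ρ⁻¹ - β) / 2 by rw [hV]; field_simp; ring]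
    refine h.congr fun n => ?_
    have h₁ := (hpos n).ne'
    rw [coeff_succ_eq hT]
    field_simp
    ring

end IL

namespace IL

open Filter Topology Finset

/-! ### Shares as solutions of a system of equations -/

theorem shareAt_eq (S : Set Symbol) (P : Formula → Prop) (n : ℕ) :
    shareAt S P n = PowerSeries.coeff n (gf S (ind P)) /
      PowerSeries.coeff n (gf S (ind fun _ => True)) := by
  classical
  have h (P : Formula → Prop) : ({F ∈ formulas S n | P F}.ncard : ℝ) =
      PowerSeries.coeff n (gf S (ind P)) := by
    rw [coeff_gf]
    simp only [ind]
    rw [Finset.sum_boole, ← Set.ncard_coe_finset]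
    congr 2
    ext F
    simp
  rw [shareAt, h, ← h fun _ => True]
  simp only [and_true, Set.ofPred_mem_eq]

theorem coeff_gf_ind_nonneg (S : Set Symbol) (P : Formula → Prop) (n : ℕ) :
    0 ≤ PowerSeries.coeff n (gf S (ind P)) := by
  rw [coeff_gf]
  exact Finset.sum_nonneg fun F _ => by unfold ind; split_ifs <;> norm_num

theorem coeff_gf_ind_mono (S : Set Symbol) {P Q : Formula → Prop} (h : ∀ F, P F → Q F) (n : ℕ) :
    PowerSeries.coeff n (gf S (ind P)) ≤ PowerSeries.coeff n (gf S (ind Q)) := by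
  rw [coeff_gf, coeff_gf]
  refine Finset.sum_le_sum fun F _ => ?_
  unfold ind
  split_ifs with h₁ h₂
  · exact le_rfl
  · exact absurd (h F h₁) h₂
  · norm_num
  · exact le_rfl

theorem shareAt_mono (S : Set Symbol) {P Q : Formula → Prop} (h : ∀ F, P F → Q F) (n : ℕ) :
    shareAt S P n ≤ shareAt S Q n := by
  rw [shareAt_eq, shareAt_eq]
  exact div_le_div_of_nonneg_right (coeff_gf_ind_mono S h n) (coeff_gf_ind_nonneg S _ n)

theorem shareAt_le_one (S : Set Symbol) (P : Formula → Prop) (n : ℕ) : shareAt S P n ≤ 1 := by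
  rw [shareAt_eq]
  exact div_le_one_of_le₀ (coeff_gf_ind_mono S (fun _ _ => trivial) n)
    (coeff_gf_ind_nonneg S _ n)

theorem le_liminf_shareAt {S : Set Symbol} {P Q : Formula → Prop} {μ : ℝ} (hP : HasShare S P μ)
    (h : ∀ F, P F → Q F) : μ ≤ liminf (shareAt S Q) atTop := by
  rw [← hP.liminf_eq]
  refine liminf_le_liminf (Eventually.of_forall (shareAt_mono S h)) hP.isBoundedUnder_ge ?_
  exact IsBoundedUnder.isCoboundedUnder_ge 
    ⟨1, eventually_map.2 (Eventually.of_forall (shareAt_le_one S Q))⟩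

/-- The equations for the values `·₀` at the singularity `ρ` and the shares `·₁` of the classes
in a `ClassSystem`; the value of the generating function of all formulas is `V`. -/
structure ShareSystem (τ β ρ V N₀ N₁ M₀ M₁ B₀ B₁ L₀ L₁ P₀ P₁ H₁ : ℝ) : Prop where
  N₀_nonneg : 0 ≤ N₀
  L₀_le : L₀ ≤ V
  P₀_nonneg : 0 ≤ P₀
  N₀_eq : N₀ = 1 + ρ * ((V - N₀) * N₀)
  N₁_eq : N₁ = ρ * ((1 - N₁) * N₀ + (V - N₀) * N₁)
  M₀_eq : M₀ = ρ * ((V - N₀) * N₀ + β * N₀)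
  M₁_eq : M₁ = ρ * ((1 - N₁) * N₀ + (V - N₀) * N₁ + β * N₁)
  B₀_eq : B₀ = ρ * (V * (V - N₀) + N₀ + (V - N₀) + N₀ * (ρ * M₀) + β * (N₀ + M₀))
  B₁_eq : B₁ = ρ * ((V - N₀) + V * (1 - N₁) + N₁ + (1 - N₁) +
    (N₁ * (ρ * M₀) + N₀ * (ρ * M₁)) + β * (N₁ + M₁))
  L₀_eq : L₀ = 1 + τ + B₀ + ρ * (L₀ * L₀ + τ * (V - L₀))
  L₁_eq : L₁ = B₁ + ρ * (2 * (L₀ * L₁) + τ * (1 - L₁))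
  P₀_eq : P₀ = 1 + ρ * ((L₀ - P₀) * P₀)
  P₁_eq : P₁ = ρ * ((L₁ - P₁) * P₀ + (L₀ - P₀) * P₁)
  H₁_eq : H₁ = B₁ + ρ * ((1 - N₁) * (N₀ - 1) + (V - N₀) * N₁ + ρ * (H₁ - M₁) + β * (H₁ - M₁) +
    (2 * (L₀ * L₁) + τ * (1 - L₁) - ((L₁ - P₁) * P₀ + (L₀ - P₀) * P₁)) +
    τ * (H₁ - (L₁ - P₁)))

theorem tsum_abs_coeff {t : ℕ → ℝ} {ρ : ℝ} {f g : PowerSeries ℝ} {v a : ℝ}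
    (hg : HasAsymptotics t ρ g v a)
    (h : ∀ n, |PowerSeries.coeff n f| = PowerSeries.coeff n g) :
    ∑' n, |PowerSeries.coeff n f| * ρ ^ n = v := by
  simp only [h]
  exact hg.hasSum.tsum_eq

theorem nonneg_of_hasAsymptotics {t : ℕ → ℝ} {ρ : ℝ} {f : PowerSeries ℝ} {v a : ℝ} (hρ : 0 < ρ)
    (hf : HasAsymptotics t ρ f v a) (h : ∀ n, 0 ≤ PowerSeries.coeff n f) : 0 ≤ v :=
  hf.hasSum.nonneg fun n => mul_nonneg (h n) (pow_pos hρ n).le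

open scoped Classical in
/-- The share of the GL-like formulas exists and is determined by a `ShareSystem`. -/
theorem exists_shareSystem {S : Set Symbol} (hbot : Symbol.bot ∈ S) (himp : Symbol.imp ∈ S)
    (hrhd : Symbol.rhd ∈ S) {τ β ρ V : ℝ} (hτ : τ = if Symbol.top ∈ S then 1 else 0)
    (hβ : β = if Symbol.box ∈ S then 1 else 0) (hρ : 0 < ρ) (hρ8 : ρ ≤ 1 / 8)
    (hD : 1 - 2 * (β + 4 * (1 + τ)) * ρ + β ^ 2 * ρ ^ 2 = 0) (hV : 4 * ρ * V = 1 - β * ρ) :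
    ∃ N₀ N₁ M₀ M₁ B₀ B₁ L₀ L₁ P₀ P₁ H₁ : ℝ,
      ShareSystem τ β ρ V N₀ N₁ M₀ M₁ B₀ B₁ L₀ L₁ P₀ P₁ H₁ ∧ HasShare S GLLike (H₁ + N₁) := by
  have sys := classSystem hbot himp hrhd
  rw [← hτ, ← hβ] at sys
  have hτ0 : 0 ≤ τ := by rw [hτ]; split_ifs <;> norm_num
  have hβ0 : 0 ≤ β := by rw [hβ]; split_ifs <;> norm_num
  have hτ1 : τ ≤ 1 := by rw [hτ]; split_ifs <;> norm_num
  have hβ1 : β ≤ 1 := by rw [hβ]; split_ifs <;> norm_num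
  have hle (P : Formula → Prop) (n : ℕ) : |PowerSeries.coeff n (gf S (ind P))| ≤
      PowerSeries.coeff n (gf S (ind fun _ => True)) := by
    rw [abs_of_nonneg (coeff_gf_ind_nonneg S P n)]
    exact coeff_gf_ind_mono S (fun _ _ => trivial) n
  have habs (P : Formula → Prop) (n : ℕ) : |PowerSeries.coeff n (gf S (ind P))| =
      PowerSeries.coeff n (gf S (ind P)) := abs_of_nonneg (coeff_gf_ind_nonneg S P n)
  have hGL : gf S (ind GLLike) =
      gf S (ind fun F => GLLike F ∧ ¬ Negative F) + gf S (ind Negative) := by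
    rw [← map_add]
    congr 1
    funext F
    by_cases hN : Negative F
    · simp [ind, hN, GLLike.negative F hN]
    · simp [ind, hN]
  have ht := subcritical_total sys.total (by linarith) hβ0 hβ1 hρ (by linarith) hD
  rw [show (1 - β * ρ) / (4 * ρ) = V by rw [← hV]; field_simp] at ht
  set t : ℕ → ℝ := fun n => PowerSeries.coeff n (gf S (ind fun _ => True)) with htdef
  set T := gf S (ind fun _ => True)
  have hTa : HasAsymptotics t ρ T V 1 :=
    ⟨ht.hasSum, tendsto_const_nhds.congr fun n => (div_self (ht.pos n).ne').symm⟩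
  have hρβ : 0 ≤ β * ρ := mul_nonneg hβ0 hρ.le
  have hρτ : ρ * τ ≤ 1 / 8 := by nlinarith
  have hρβ' : ρ * β ≤ 1 / 8 := by nlinarith
  set N := gf S (ind Negative) with hNdef
  obtain ⟨N₀, N₁, hN, hNV⟩ := HasAsymptotics.exists_of_quadratic ht (hle Negative)
    HasAsymptotics.one hTa (κ := -1) (by
      rw [← hNdef]
      nth_rw 1 [sys.negative]
      simp only [map_neg, map_one]
      ring) (by
      rw [tsum_abs_coeff hTa (habs _), abs_neg, abs_one]
      linarith)
  rw [← hNdef] at hN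
  have hN₀ := nonneg_of_hasAsymptotics hρ hN (coeff_gf_ind_nonneg S _)
  have hTN := (hTa.sub hN).mul ht hN
  obtain ⟨eN₀, eN₁⟩ := hN.unique sys.negative (HasAsymptotics.one.add (hTN.X_mul ht))
  set M := gf S (ind Direct)
  have hM := HasAsymptotics.of_eq sys.direct ((hTN.add (hN.const_mul β)).X_mul ht)
  set M₀ := ρ * ((V - N₀) * N₀ + β * N₀) with hM₀
  set M₁ := ρ * ((1 - N₁) * N₀ + (V - N₀) * N₁ + β * N₁) with hM₁
  have hX := HasAsymptotics.of_eq sys.cross (hM.X_mul ht)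
  set B := gf S (ind BasicLocallyGLLike)
  have hB := HasAsymptotics.of_eq sys.basic ((((((hTa.mul ht (hTa.sub hN)).add hN).add
    (hTa.sub hN)).add (hN.mul ht hX)).add ((hN.add hM).const_mul β)).X_mul ht)
  set B₀ := ρ * (V * (V - N₀) + N₀ + (V - N₀) + N₀ * (ρ * M₀) + β * (N₀ + M₀)) with hB₀
  set B₁ := ρ * (1 * (V - N₀) + V * (1 - N₁) + N₁ + (1 - N₁) +
    (N₁ * (ρ * M₀) + N₀ * (ρ * M₁)) + β * (N₁ + M₁)) with hB₁
  set L := gf S (ind LocallyGLLike) with hLdef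
  obtain ⟨L₀, L₁, hL, hLV⟩ := HasAsymptotics.exists_of_quadratic ht (hle LocallyGLLike)
    (((HasAsymptotics.const (1 + τ)).add hB).add ((hTa.const_mul τ).X_mul ht))
    (HasAsymptotics.const (-τ)) (κ := 1) (by
      rw [← hLdef]
      nth_rw 1 [sys.locally]
      simp only [map_neg, map_one]
      ring) (by
      rw [tsum_abs_coeff (HasAsymptotics.const (t := t) τ) fun n => by
        simp only [PowerSeries.coeff_C]
        split_ifs
        · rw [abs_neg, abs_of_nonneg hτ0]
        · simp, abs_one]
      linarith)
  rw [← hLdef] at hL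
  have hLI := (hL.mul ht hL).add ((hTa.sub hL).const_mul τ)
  obtain ⟨eL₀, eL₁⟩ := hL.unique sys.locally
    (((HasAsymptotics.const (1 + τ)).add hB).add (hLI.X_mul ht))
  set P := gf S (ind fun F => LocallyGLLike F ∧ Negative F) with hPdef
  obtain ⟨P₀, P₁, hP, hPV⟩ := HasAsymptotics.exists_of_quadratic ht
    (hle fun F => LocallyGLLike F ∧ Negative F) HasAsymptotics.one hL (κ := -1) (by
      rw [← hPdef]
      nth_rw 1 [sys.locallyNegative]
      simp only [map_neg, map_one]
      ring) (by
      rw [tsum_abs_coeff hL (habs _), abs_neg, abs_one]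
      nlinarith [le_of_abs_le hLV])
  rw [← hPdef] at hP
  have hP₀ := nonneg_of_hasAsymptotics hρ hP (coeff_gf_ind_nonneg S _)
  have hLP := (hL.sub hP).mul ht hP
  obtain ⟨eP₀, eP₁⟩ := hP.unique sys.locallyNegative (HasAsymptotics.one.add (hLP.X_mul ht))
  set H := gf S (ind fun F => GLLike F ∧ ¬ Negative F) with hHdef
  have hNA := (hTa.sub hN).mul ht (hN.sub HasAsymptotics.one)
  have hh := (HasAsymptotics.one.X_mul ht).add (HasAsymptotics.const (t := t) (ρ := ρ) (β + τ))
  obtain ⟨H₀, H₁, hH, -⟩ := HasAsymptotics.exists_of_quadratic ht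
    (hle fun F => GLLike F ∧ ¬ Negative F)
    (((HasAsymptotics.const τ).add hB).add (((((hNA.sub (hM.X_mul ht)).sub
      (hM.const_mul β)).add (hLI.sub hLP)).sub ((hL.sub hP).const_mul τ)).X_mul ht))
    hh (κ := 0) (by
      rw [← hHdef]
      nth_rw 1 [sys.affirmative]
      rw [sys.negated]
      simp only [map_add, map_zero]
      ring) (by
      rw [tsum_abs_coeff hh fun n => abs_of_nonneg ?_]
      · rw [abs_zero]
        nlinarith
      · simp only [mul_one, map_add, PowerSeries.coeff_X, PowerSeries.coeff_C]
        split_ifs <;> positivity)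
  rw [← hHdef] at hH
  have hY := HasAsymptotics.of_eq sys.negated ((hH.sub hM).X_mul ht)
  obtain ⟨-, eH₁⟩ := hH.unique sys.affirmative (((HasAsymptotics.const τ).add hB).add
    (((((hNA.add hY).add ((hH.sub hM).const_mul β)).add (hLI.sub hLP)).add
      ((hH.sub (hL.sub hP)).const_mul τ)).X_mul ht))
  refine ⟨N₀, N₁, M₀, M₁, B₀, B₁, L₀, L₁, P₀, P₁, H₁, ⟨hN₀, le_of_abs_le hLV, hP₀, eN₀, ?_,
    hM₀, hM₁, hB₀, ?_, eL₀, ?_, eP₀, ?_, ?_⟩, ?_⟩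
  · linear_combination eN₁
  · rw [hB₁]; ring
  · linear_combination eL₁
  · linear_combination eP₁
  · linear_combination eH₁
  · have h := (hH.add hN).tendsto
    rw [← hGL] at h
    exact h.congr fun n => (shareAt_eq S GLLike n).symm

end IL

namespace IL

/-! ### Numerical enclosures -/

/-- The equations of a `ShareSystem` solved for the unknowns one after the other. -/
structure ReducedShareSystem (τ β ρ V N₀ N₁ M₀ M₁ B₀ B₁ L₀ L₁ P₀ P₁ H₁ : ℝ) : Prop where
  N₀_eq : ρ * N₀ ^ 2 + (1 - ρ * V) * N₀ = 1
  N₁_eq : N₁ * (1 - ρ * V + 2 * (ρ * N₀)) = ρ * N₀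
  M₀_eq : M₀ = N₀ - 1 + β * (ρ * N₀)
  M₁_eq : M₁ = N₁ + β * (ρ * N₁)
  B₀_eq : B₀ = ρ * V * (V + 1 - N₀) + ρ * N₀ * (ρ * M₀) + β * (ρ * N₀ + ρ * M₀)
  B₁_eq : B₁ = 2 * (ρ * V) - ρ * N₀ - ρ * V * N₁ + ρ + ρ * N₁ * (ρ * M₀) + ρ * N₀ * (ρ * M₁) +
    β * (ρ * N₁ + ρ * M₁)
  L₀_eq : (1 + τ * ρ) * L₀ - ρ * L₀ ^ 2 = 1 + τ + B₀ + τ * (ρ * V)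
  L₁_eq : L₁ * (1 + τ * ρ - 2 * (ρ * L₀)) = B₁ + τ * ρ
  P₀_eq : ρ * P₀ ^ 2 + (1 - ρ * L₀) * P₀ = 1
  P₁_eq : P₁ * (1 - ρ * L₀ + 2 * (ρ * P₀)) = ρ * P₀ * L₁
  H₁_eq : H₁ * (1 - ρ * ρ - β * ρ - τ * ρ) = N₁ - ρ + ρ * N₁ - ρ * (ρ * M₁) - β * (ρ * M₁) +
    (L₁ - P₁) - τ * (ρ * (L₁ - P₁))

theorem ShareSystem.reduced {τ β ρ V N₀ N₁ M₀ M₁ B₀ B₁ L₀ L₁ P₀ P₁ H₁ : ℝ}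
    (h : ShareSystem τ β ρ V N₀ N₁ M₀ M₁ B₀ B₁ L₀ L₁ P₀ P₁ H₁) :
    ReducedShareSystem τ β ρ V N₀ N₁ M₀ M₁ B₀ B₁ L₀ L₁ P₀ P₁ H₁ where
  N₀_eq := by linear_combination h.N₀_eq
  N₁_eq := by linear_combination h.N₁_eq
  M₀_eq := by linear_combination h.M₀_eq - h.N₀_eq
  M₁_eq := by linear_combination h.M₁_eq - h.N₁_eq
  B₀_eq := by linear_combination h.B₀_eq
  B₁_eq := by linear_combination h.B₁_eq
  L₀_eq := by linear_combination h.L₀_eq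
  L₁_eq := by linear_combination h.L₁_eq
  P₀_eq := by linear_combination h.P₀_eq
  P₁_eq := by linear_combination h.P₁_eq
  H₁_eq := by linear_combination h.H₁_eq - h.N₁_eq - h.L₁_eq + h.P₁_eq

theorem mul_bounds {x y a b c d lo hi : ℝ} (hxl : a ≤ x) (hxu : x ≤ b) (hyl : c ≤ y)
    (hyu : y ≤ d) (ha : 0 ≤ a) (hc : 0 ≤ c) (hlo : lo ≤ a * c) (hhi : b * d ≤ hi) :
    lo ≤ x * y ∧ x * y ≤ hi :=
  ⟨hlo.trans (mul_le_mul hxl hyl hc (ha.trans hxl)),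
    (mul_le_mul hxu hyu (hc.trans hyl) (ha.trans (hxl.trans hxu))).trans hhi⟩

theorem quotient_bounds {x n d n₁ n₂ d₁ d₂ lo hi : ℝ} (h : x * d = n) (hnl : n₁ ≤ n)
    (hnu : n ≤ n₂) (hdl : d₁ ≤ d) (hdu : d ≤ d₂) (hd : 0 < d₁) (hlo0 : 0 ≤ lo) (hhi0 : 0 ≤ hi)
    (hlo : lo * d₂ ≤ n₁) (hhi : n₂ ≤ hi * d₁) : lo ≤ x ∧ x ≤ hi := by
  have hd0 : 0 < d := hd.trans_le hdl
  refine ⟨le_of_mul_le_mul_right ?_ hd0, le_of_mul_le_mul_right ?_ hd0⟩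
  · linarith [mul_le_mul_of_nonneg_left hdu hlo0]
  · linarith [mul_le_mul_of_nonneg_left hdl hhi0]

/-- Bounds for the positive solution of a quadratic equation with positive coefficients. -/
theorem quadratic_bounds {x r c r₁ r₂ c₁ c₂ lo hi : ℝ} (hx : 0 ≤ x) (h : r * x ^ 2 + c * x = 1)
    (hrl : r₁ ≤ r) (hru : r ≤ r₂) (hcl : c₁ ≤ c) (hcu : c ≤ c₂) (hr : 0 < r₁) (hc : 0 < c₁)
    (hlo0 : 0 ≤ lo) (hhi0 : 0 ≤ hi) (hlo : r₂ * lo ^ 2 + c₂ * lo ≤ 1)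
    (hhi : 1 ≤ r₁ * hi ^ 2 + c₁ * hi) : lo ≤ x ∧ x ≤ hi := by
  have hr0 : 0 < r := hr.trans_le hrl
  have hc0 : 0 < c := hc.trans_le hcl
  have hmono {y z : ℝ} (hy : 0 ≤ y) (hyz : y < z) : r * y ^ 2 + c * y < r * z ^ 2 + c * z := by
    gcongr
  constructor
  · by_contra hlt
    have h₁ := hmono hx (not_le.1 hlt)
    have h₂ : r * lo ^ 2 + c * lo ≤ r₂ * lo ^ 2 + c₂ * lo := by gcongr
    linarith
  · by_contra hlt
    have h₁ := hmono hhi0 (not_le.1 hlt)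
    have h₂ : r₁ * hi ^ 2 + c₁ * hi ≤ r * hi ^ 2 + c * hi := by gcongr
    linarith

/-- Bounds for the smaller solution of `p x - r x² = q`. -/
theorem small_root_bounds {x V r p q r₁ r₂ p₁ p₂ q₁ q₂ lo hi : ℝ} (hxV : x ≤ V)
    (h : p * x - r * x ^ 2 = q) (hrl : r₁ ≤ r) (hru : r ≤ r₂) (hpl : p₁ ≤ p) (hpu : p ≤ p₂)
    (hql : q₁ ≤ q) (hqu : q ≤ q₂) (hV : r * V ≤ 1 / 4) (hr : 0 < r₁) (hp : 1 ≤ p₁)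
    (hlo0 : 0 ≤ lo) (hhi0 : r₂ * hi ≤ 1 / 2 ∧ r₂ * lo ≤ 1 / 2 ∧ 0 ≤ hi)
    (hlo : p₂ * lo - r₁ * lo ^ 2 ≤ q₁) (hhi : q₂ ≤ p₁ * hi - r₂ * hi ^ 2) :
    lo ≤ x ∧ x ≤ hi := by
  obtain ⟨hhi1, hlo1, hhi0⟩ := hhi0
  have hr0 : 0 < r := hr.trans_le hrl
  have hrx : r * x ≤ 1 / 4 := (mul_le_mul_of_nonneg_left hxV hr0.le).trans hV
  constructor
  · by_contra hlt
    have hlt := not_le.1 hlt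
    have h₁ : r * lo ≤ 1 / 2 := (mul_le_mul_of_nonneg_right hru hlo0).trans hlo1
    have h₂ : 0 < (lo - x) * (p - r * (lo + x)) :=
      mul_pos (by linarith) (by linarith)
    have h₃ : p * lo ≤ p₂ * lo := mul_le_mul_of_nonneg_right hpu hlo0
    have h₄ : r₁ * lo ^ 2 ≤ r * lo ^ 2 := by gcongr
    linarith
  · by_contra hlt
    have hlt := not_le.1 hlt
    have h₁ : r * hi ≤ 1 / 2 := (mul_le_mul_of_nonneg_right hru hhi0).trans hhi1
    have h₂ : 0 < (x - hi) * (p - r * (x + hi)) :=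
      mul_pos (by linarith) (by linarith)
    have h₃ : p₁ * hi ≤ p * hi := mul_le_mul_of_nonneg_right hpl hhi0
    have h₄ : r * hi ^ 2 ≤ r₂ * hi ^ 2 := by gcongr
    linarith

/-- Enclosure of the share for the alphabet `⊥, →, ▷`. -/
theorem share_bounds_bot_imp_rhd {N₀ N₁ M₀ M₁ B₀ B₁ L₀ L₁ P₀ P₁ H₁ : ℝ}
    (h : ShareSystem 0 0 (1 / 8) 2 N₀ N₁ M₀ M₁ B₀ B₁ L₀ L₁ P₀ P₁ H₁) :
    0.93771 ≤ H₁ + N₁ ∧ H₁ + N₁ < 0.93772 := by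
  obtain ⟨ρ, hρ⟩ : ∃ ρ : ℝ, ρ = 1 / 8 := ⟨_, rfl⟩
  obtain ⟨V, hV⟩ : ∃ V : ℝ, V = 2 := ⟨_, rfl⟩
  rw [← hρ, ← hV] at h
  have hρV : 4 * ρ * V = 1 - 0 * ρ := by rw [hρ, hV]; norm_num
  have hρl : 0.125 ≤ ρ := by rw [hρ]; norm_num
  have hρu : ρ ≤ 0.125 := by rw [hρ]; norm_num
  have hVl : 2 ≤ V := hV.ge
  have hVu : V ≤ 2 := hV.le
  have r := h.reduced
  have eM₀ := r.M₀_eq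
  have eM₁ := r.M₁_eq
  have eB₀ := r.B₀_eq
  have eB₁ := r.B₁_eq
  obtain ⟨hal, hau⟩ : 0.25 ≤ ρ * V ∧ ρ * V ≤ 0.25 := by
    constructor <;> linarith only [hρV, hρl, hρu]
  obtain ⟨hcl, hcu⟩ : 0.75 ≤ 1 - ρ * V ∧ 1 - ρ * V ≤ 0.75 := by
    constructor <;> linarith only [hal, hau]
  obtain ⟨hNl, hNu⟩ : 1.123105625 ≤ N₀ ∧ N₀ ≤ 1.123105626 :=
    quadratic_bounds h.N₀_nonneg r.N₀_eq hρl hρu hcl hcu (by norm_num) (by norm_num)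
      (by norm_num) (by norm_num) (by norm_num) (by norm_num)
  obtain ⟨hRNl, hRNu⟩ : 0.140388203 ≤ ρ * N₀ ∧ ρ * N₀ ≤ 0.140388204 :=
    mul_bounds hρl hρu hNl hNu (by norm_num) (by norm_num) (by norm_num) (by norm_num)
  obtain ⟨hdl, hdu⟩ : 1.030776406 ≤ 1 - ρ * V + 2 * (ρ * N₀) ∧
      1 - ρ * V + 2 * (ρ * N₀) ≤ 1.030776408 := by
    constructor <;> linarith only [hcl, hcu, hRNl, hRNu]
  obtain ⟨hN1l, hN1u⟩ : 0.136196562 ≤ N₁ ∧ N₁ ≤ 0.136196564 :=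
    quotient_bounds r.N₁_eq hRNl hRNu hdl hdu (by norm_num) (by norm_num) (by norm_num)
      (by norm_num) (by norm_num)
  obtain ⟨hMl, hMu⟩ : 0.123105625 ≤ M₀ ∧ M₀ ≤ 0.123105626 := by
    constructor <;> linarith only [eM₀, hNl, hNu, hRNl, hRNu]
  obtain ⟨hRN1l, hRN1u⟩ : 0.01702457 ≤ ρ * N₁ ∧ ρ * N₁ ≤ 0.017024571 :=
    mul_bounds hρl hρu hN1l hN1u (by norm_num) (by norm_num) (by norm_num) (by norm_num)
  obtain ⟨hM1l, hM1u⟩ : 0.136196562 ≤ M₁ ∧ M₁ ≤ 0.136196564 := by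
    constructor <;> linarith only [eM₁, hN1l, hN1u, hRN1l, hRN1u]
  obtain ⟨hRMl, hRMu⟩ : 0.015388203 ≤ ρ * M₀ ∧ ρ * M₀ ≤ 0.015388204 :=
    mul_bounds hρl hρu hMl hMu (by norm_num) (by norm_num) (by norm_num) (by norm_num)
  obtain ⟨hRM1l, hRM1u⟩ : 0.01702457 ≤ ρ * M₁ ∧ ρ * M₁ ≤ 0.017024571 :=
    mul_bounds hρl hρu hM1l hM1u (by norm_num) (by norm_num) (by norm_num) (by norm_num)
  obtain ⟨hNMl, hNMu⟩ : 0.002160322 ≤ ρ * N₀ * (ρ * M₀) ∧ ρ * N₀ * (ρ * M₀) ≤ 0.002160323 :=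
    mul_bounds hRNl hRNu hRMl hRMu (by norm_num) (by norm_num) (by norm_num) (by norm_num)
  obtain ⟨hN1Ml, hN1Mu⟩ : 0.000261977 ≤ ρ * N₁ * (ρ * M₀) ∧ ρ * N₁ * (ρ * M₀) ≤ 0.000261978 :=
    mul_bounds hRN1l hRN1u hRMl hRMu (by norm_num) (by norm_num) (by norm_num) (by norm_num)
  obtain ⟨hNM1l, hNM1u⟩ : 0.002390048 ≤ ρ * N₀ * (ρ * M₁) ∧ ρ * N₀ * (ρ * M₁) ≤ 0.002390049 :=
    mul_bounds hRNl hRNu hRM1l hRM1u (by norm_num) (by norm_num) (by norm_num) (by norm_num)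
  obtain ⟨hel, heu⟩ : 1.876894374 ≤ V + 1 - N₀ ∧ V + 1 - N₀ ≤ 1.876894375 := by
    constructor <;> linarith only [hVl, hVu, hNl, hNu]
  obtain ⟨hael, haeu⟩ : 0.469223593 ≤ ρ * V * (V + 1 - N₀) ∧ ρ * V * (V + 1 - N₀) ≤ 0.469223594 :=
    mul_bounds hal hau hel heu (by norm_num) (by norm_num) (by norm_num) (by norm_num)
  obtain ⟨haN1l, haN1u⟩ : 0.03404914 ≤ ρ * V * N₁ ∧ ρ * V * N₁ ≤ 0.034049141 :=
    mul_bounds hal hau hN1l hN1u (by norm_num) (by norm_num) (by norm_num) (by norm_num)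
  obtain ⟨hBl, hBu⟩ : 0.471383915 ≤ B₀ ∧ B₀ ≤ 0.471383917 := by
    constructor <;> linarith only [eB₀, hael, haeu, hNMl, hNMu, hRNl, hRNu, hRMl, hRMu]
  obtain ⟨hB1l, hB1u⟩ : 0.45321468 ≤ B₁ ∧ B₁ ≤ 0.453214684 := by
    constructor <;> linarith only [eB₁, hal, hau, hRNl, hRNu, haN1l, haN1u, hρl, hρu, hN1Ml,
      hN1Mu, hNM1l, hNM1u, hRN1l, hRN1u, hRM1l, hRM1u]
  obtain ⟨hpl, hpu⟩ : 1.0 ≤ 1 + 0 * ρ ∧ 1 + 0 * ρ ≤ 1.0 := by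
    constructor <;> linarith only [hρl, hρu]
  obtain ⟨hql, hqu⟩ : 1.471383915 ≤ 1 + 0 + B₀ + 0 * (ρ * V) ∧
      1 + 0 + B₀ + 0 * (ρ * V) ≤ 1.471383917 := by
    constructor <;> linarith only [hBl, hBu, hal, hau]
  obtain ⟨hLl, hLu⟩ : 1.943564083 ≤ L₀ ∧ L₀ ≤ 1.943564088 :=
    small_root_bounds h.L₀_le r.L₀_eq hρl hρu hpl hpu hql hqu (by linarith only [hau])
      (by norm_num) (by norm_num) (by norm_num) (by norm_num) (by norm_num) (by norm_num)
  obtain ⟨hRLl, hRLu⟩ : 0.24294551 ≤ ρ * L₀ ∧ ρ * L₀ ≤ 0.242945511 :=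
    mul_bounds hρl hρu hLl hLu (by norm_num) (by norm_num) (by norm_num) (by norm_num)
  obtain ⟨hnl, hnu⟩ : 0.45321468 ≤ B₁ + 0 * ρ ∧ B₁ + 0 * ρ ≤ 0.453214684 := by
    constructor <;> linarith only [hB1l, hB1u, hρl, hρu]
  obtain ⟨hdLl, hdLu⟩ : 0.514108978 ≤ 1 + 0 * ρ - 2 * (ρ * L₀) ∧
      1 + 0 * ρ - 2 * (ρ * L₀) ≤ 0.51410898 := by
    constructor <;> linarith only [hρl, hρu, hRLl, hRLu]
  obtain ⟨hL1l, hL1u⟩ : 0.881553712 ≤ L₁ ∧ L₁ ≤ 0.881553724 :=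
    quotient_bounds r.L₁_eq hnl hnu hdLl hdLu (by norm_num) (by norm_num) (by norm_num)
      (by norm_num) (by norm_num)
  obtain ⟨hcPl, hcPu⟩ : 0.757054489 ≤ 1 - ρ * L₀ ∧ 1 - ρ * L₀ ≤ 0.75705449 := by
    constructor <;> linarith only [hRLl, hRLu]
  obtain ⟨hPl, hPu⟩ : 1.115464461 ≤ P₀ ∧ P₀ ≤ 1.115464463 :=
    quadratic_bounds h.P₀_nonneg r.P₀_eq hρl hρu hcPl hcPu (by norm_num) (by norm_num)
      (by norm_num) (by norm_num) (by norm_num) (by norm_num)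
  obtain ⟨hRPl, hRPu⟩ : 0.139433057 ≤ ρ * P₀ ∧ ρ * P₀ ≤ 0.139433058 :=
    mul_bounds hρl hρu hPl hPu (by norm_num) (by norm_num) (by norm_num) (by norm_num)
  obtain ⟨hPLl, hPLu⟩ : 0.122917728 ≤ ρ * P₀ * L₁ ∧ ρ * P₀ * L₁ ≤ 0.122917732 :=
    mul_bounds hRPl hRPu hL1l hL1u (by norm_num) (by norm_num) (by norm_num) (by norm_num)
  obtain ⟨hdPl, hdPu⟩ : 1.035920603 ≤ 1 - ρ * L₀ + 2 * (ρ * P₀) ∧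
      1 - ρ * L₀ + 2 * (ρ * P₀) ≤ 1.035920606 := by
    constructor <;> linarith only [hcPl, hcPu, hRPl, hRPu]
  obtain ⟨hP1l, hP1u⟩ : 0.118655548 ≤ P₁ ∧ P₁ ≤ 0.118655553 :=
    quotient_bounds r.P₁_eq hPLl hPLu hdPl hdPu (by norm_num) (by norm_num) (by norm_num)
      (by norm_num) (by norm_num)
  obtain ⟨hρρl, hρρu⟩ : 0.015625 ≤ ρ * ρ ∧ ρ * ρ ≤ 0.015625 :=
    mul_bounds hρl hρu hρl hρu (by norm_num) (by norm_num) (by norm_num) (by norm_num)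
  obtain ⟨hρMl, hρMu⟩ : 0.002128071 ≤ ρ * (ρ * M₁) ∧ ρ * (ρ * M₁) ≤ 0.002128072 :=
    mul_bounds hρl hρu hRM1l hRM1u (by norm_num) (by norm_num) (by norm_num) (by norm_num)
  obtain ⟨hnHl, hnHu⟩ : 0.788991219 ≤ N₁ - ρ + ρ * N₁ - ρ * (ρ * M₁) - 0 * (ρ * M₁) + (L₁ - P₁) -
      0 * (ρ * (L₁ - P₁)) ∧
      N₁ - ρ + ρ * N₁ - ρ * (ρ * M₁) - 0 * (ρ * M₁) + (L₁ - P₁) -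
      0 * (ρ * (L₁ - P₁)) ≤ 0.78899124 := by
    constructor <;> linarith only [hN1l, hN1u, hρl, hρu, hRN1l, hRN1u, hρMl, hρMu, hRM1l, hRM1u,
      hL1l, hL1u, hP1l, hP1u]
  obtain ⟨hdHl, hdHu⟩ : 0.984375 ≤ 1 - ρ * ρ - 0 * ρ - 0 * ρ ∧
      1 - ρ * ρ - 0 * ρ - 0 * ρ ≤ 0.984375 := by
    constructor <;> linarith only [hρρl, hρρu, hρl, hρu]
  obtain ⟨hHl, hHu⟩ : 0.801514889 ≤ H₁ ∧ H₁ ≤ 0.801514911 :=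
    quotient_bounds r.H₁_eq hnHl hnHu hdHl hdHu (by norm_num) (by norm_num) (by norm_num)
      (by norm_num) (by norm_num)
  constructor <;> linarith only [hHl, hHu, hN1l, hN1u]

/-- Enclosure of the share for the alphabet `⊥, →, ▷, □`. -/
theorem share_bounds_bot_imp_rhd_box {N₀ N₁ M₀ M₁ B₀ B₁ L₀ L₁ P₀ P₁ H₁ : ℝ}
    {ρ V : ℝ} (hρ : ρ = 5 - √24) (hV : V = (4 + √24) / 4)
    (h : ShareSystem 0 1 ρ V N₀ N₁ M₀ M₁ B₀ B₁ L₀ L₁ P₀ P₁ H₁) :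
    0.86653 ≤ H₁ + N₁ ∧ H₁ + N₁ < 0.86654 := by
  have hs : √24 * √24 = (24 : ℝ) := Real.mul_self_sqrt (by norm_num)
  have hsl : 4.898979485 ≤ √(24 : ℝ) := Real.le_sqrt_of_sq_le (by norm_num)
  have hsu : √(24 : ℝ) ≤ 4.898979486 := Real.sqrt_le_iff.2 (by norm_num)
  have hρV : 4 * ρ * V = 1 - 1 * ρ := by rw [hρ, hV]; linear_combination -hs
  have hρl : 0.101020514 ≤ ρ := by linarith
  have hρu : ρ ≤ 0.101020515 := by linarith
  have hVl : 2.224744871 ≤ V := by linarith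
  have hVu : V ≤ 2.224744872 := by linarith
  have r := h.reduced
  have eM₀ := r.M₀_eq
  have eM₁ := r.M₁_eq
  have eB₀ := r.B₀_eq
  have eB₁ := r.B₁_eq
  obtain ⟨hal, hau⟩ : 0.224744871 ≤ ρ * V ∧ ρ * V ≤ 0.224744872 := by
    constructor <;> linarith only [hρV, hρl, hρu]
  obtain ⟨hcl, hcu⟩ : 0.775255128 ≤ 1 - ρ * V ∧ 1 - ρ * V ≤ 0.775255129 := by
    constructor <;> linarith only [hal, hau]
  obtain ⟨hNl, hNu⟩ : 1.124983931 ≤ N₀ ∧ N₀ ≤ 1.124983934 :=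
    quadratic_bounds h.N₀_nonneg r.N₀_eq hρl hρu hcl hcu (by norm_num) (by norm_num)
      (by norm_num) (by norm_num) (by norm_num) (by norm_num)
  obtain ⟨hRNl, hRNu⟩ : 0.113646454 ≤ ρ * N₀ ∧ ρ * N₀ ≤ 0.113646457 :=
    mul_bounds hρl hρu hNl hNu (by norm_num) (by norm_num) (by norm_num) (by norm_num)
  obtain ⟨hdl, hdu⟩ : 1.002548036 ≤ 1 - ρ * V + 2 * (ρ * N₀) ∧
      1 - ρ * V + 2 * (ρ * N₀) ≤ 1.002548043 := by
    constructor <;> linarith only [hcl, hcu, hRNl, hRNu]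
  obtain ⟨hN1l, hN1u⟩ : 0.113357613 ≤ N₁ ∧ N₁ ≤ 0.113357618 :=
    quotient_bounds r.N₁_eq hRNl hRNu hdl hdu (by norm_num) (by norm_num) (by norm_num)
      (by norm_num) (by norm_num)
  obtain ⟨hMl, hMu⟩ : 0.238630385 ≤ M₀ ∧ M₀ ≤ 0.238630391 := by
    constructor <;> linarith only [eM₀, hNl, hNu, hRNl, hRNu]
  obtain ⟨hRN1l, hRN1u⟩ : 0.011451444 ≤ ρ * N₁ ∧ ρ * N₁ ≤ 0.011451445 :=
    mul_bounds hρl hρu hN1l hN1u (by norm_num) (by norm_num) (by norm_num) (by norm_num)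
  obtain ⟨hM1l, hM1u⟩ : 0.124809057 ≤ M₁ ∧ M₁ ≤ 0.124809063 := by
    constructor <;> linarith only [eM₁, hN1l, hN1u, hRN1l, hRN1u]
  obtain ⟨hRMl, hRMu⟩ : 0.024106564 ≤ ρ * M₀ ∧ ρ * M₀ ≤ 0.024106565 :=
    mul_bounds hρl hρu hMl hMu (by norm_num) (by norm_num) (by norm_num) (by norm_num)
  obtain ⟨hRM1l, hRM1u⟩ : 0.012608275 ≤ ρ * M₁ ∧ ρ * M₁ ≤ 0.012608276 :=
    mul_bounds hρl hρu hM1l hM1u (by norm_num) (by norm_num) (by norm_num) (by norm_num)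
  obtain ⟨hNMl, hNMu⟩ : 0.002739625 ≤ ρ * N₀ * (ρ * M₀) ∧ ρ * N₀ * (ρ * M₀) ≤ 0.002739626 :=
    mul_bounds hRNl hRNu hRMl hRMu (by norm_num) (by norm_num) (by norm_num) (by norm_num)
  obtain ⟨hN1Ml, hN1Mu⟩ : 0.000276054 ≤ ρ * N₁ * (ρ * M₀) ∧ ρ * N₁ * (ρ * M₀) ≤ 0.000276056 :=
    mul_bounds hRN1l hRN1u hRMl hRMu (by norm_num) (by norm_num) (by norm_num) (by norm_num)
  obtain ⟨hNM1l, hNM1u⟩ : 0.001432885 ≤ ρ * N₀ * (ρ * M₁) ∧ ρ * N₀ * (ρ * M₁) ≤ 0.001432886 :=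
    mul_bounds hRNl hRNu hRM1l hRM1u (by norm_num) (by norm_num) (by norm_num) (by norm_num)
  obtain ⟨hel, heu⟩ : 2.099760937 ≤ V + 1 - N₀ ∧ V + 1 - N₀ ≤ 2.099760941 := by
    constructor <;> linarith only [hVl, hVu, hNl, hNu]
  obtain ⟨hael, haeu⟩ : 0.4719105 ≤ ρ * V * (V + 1 - N₀) ∧ ρ * V * (V + 1 - N₀) ≤ 0.471910504 :=
    mul_bounds hal hau hel heu (by norm_num) (by norm_num) (by norm_num) (by norm_num)
  obtain ⟨haN1l, haN1u⟩ : 0.025476542 ≤ ρ * V * N₁ ∧ ρ * V * N₁ ≤ 0.025476544 :=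
    mul_bounds hal hau hN1l hN1u (by norm_num) (by norm_num) (by norm_num) (by norm_num)
  obtain ⟨hBl, hBu⟩ : 0.612403143 ≤ B₀ ∧ B₀ ≤ 0.612403152 := by
    constructor <;> linarith only [eB₀, hael, haeu, hNMl, hNMu, hRNl, hRNu, hRMl, hRMu]
  obtain ⟨hB1l, hB1u⟩ : 0.437155913 ≤ B₁ ∧ B₁ ≤ 0.437155926 := by
    constructor <;> linarith only [eB₁, hal, hau, hRNl, hRNu, haN1l, haN1u, hρl, hρu, hN1Ml,
      hN1Mu, hNM1l, hNM1u, hRN1l, hRN1u, hRM1l, hRM1u]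
  obtain ⟨hpl, hpu⟩ : 1.0 ≤ 1 + 0 * ρ ∧ 1 + 0 * ρ ≤ 1.0 := by
    constructor <;> linarith only [hρl, hρu]
  obtain ⟨hql, hqu⟩ : 1.612403143 ≤ 1 + 0 + B₀ + 0 * (ρ * V) ∧
      1 + 0 + B₀ + 0 * (ρ * V) ≤ 1.612403152 := by
    constructor <;> linarith only [hBl, hBu, hal, hau]
  obtain ⟨hLl, hLu⟩ : 2.027794499 ≤ L₀ ∧ L₀ ≤ 2.027794522 :=
    small_root_bounds h.L₀_le r.L₀_eq hρl hρu hpl hpu hql hqu (by linarith only [hau])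
      (by norm_num) (by norm_num) (by norm_num) (by norm_num) (by norm_num) (by norm_num)
  obtain ⟨hRLl, hRLu⟩ : 0.204848842 ≤ ρ * L₀ ∧ ρ * L₀ ≤ 0.204848847 :=
    mul_bounds hρl hρu hLl hLu (by norm_num) (by norm_num) (by norm_num) (by norm_num)
  obtain ⟨hnl, hnu⟩ : 0.437155913 ≤ B₁ + 0 * ρ ∧ B₁ + 0 * ρ ≤ 0.437155926 := by
    constructor <;> linarith only [hB1l, hB1u, hρl, hρu]
  obtain ⟨hdLl, hdLu⟩ : 0.590302306 ≤ 1 + 0 * ρ - 2 * (ρ * L₀) ∧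
      1 + 0 * ρ - 2 * (ρ * L₀) ≤ 0.590302316 := by
    constructor <;> linarith only [hρl, hρu, hRLl, hRLu]
  obtain ⟨hL1l, hL1u⟩ : 0.740562761 ≤ L₁ ∧ L₁ ≤ 0.740562796 :=
    quotient_bounds r.L₁_eq hnl hnu hdLl hdLu (by norm_num) (by norm_num) (by norm_num)
      (by norm_num) (by norm_num)
  obtain ⟨hcPl, hcPu⟩ : 0.795151153 ≤ 1 - ρ * L₀ ∧ 1 - ρ * L₀ ≤ 0.795151158 := by
    constructor <;> linarith only [hRLl, hRLu]
  obtain ⟨hPl, hPu⟩ : 1.103044994 ≤ P₀ ∧ P₀ ≤ 1.103045002 :=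
    quadratic_bounds h.P₀_nonneg r.P₀_eq hρl hρu hcPl hcPu (by norm_num) (by norm_num)
      (by norm_num) (by norm_num) (by norm_num) (by norm_num)
  obtain ⟨hRPl, hRPu⟩ : 0.111430172 ≤ ρ * P₀ ∧ ρ * P₀ ≤ 0.111430175 :=
    mul_bounds hρl hρu hPl hPu (by norm_num) (by norm_num) (by norm_num) (by norm_num)
  obtain ⟨hPLl, hPLu⟩ : 0.082521035 ≤ ρ * P₀ * L₁ ∧ ρ * P₀ * L₁ ≤ 0.082521042 :=
    mul_bounds hRPl hRPu hL1l hL1u (by norm_num) (by norm_num) (by norm_num) (by norm_num)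
  obtain ⟨hdPl, hdPu⟩ : 1.018011497 ≤ 1 - ρ * L₀ + 2 * (ρ * P₀) ∧
      1 - ρ * L₀ + 2 * (ρ * P₀) ≤ 1.018011508 := by
    constructor <;> linarith only [hcPl, hcPu, hRPl, hRPu]
  obtain ⟨hP1l, hP1u⟩ : 0.081061004 ≤ P₁ ∧ P₁ ≤ 0.081061012 :=
    quotient_bounds r.P₁_eq hPLl hPLu hdPl hdPu (by norm_num) (by norm_num) (by norm_num)
      (by norm_num) (by norm_num)
  obtain ⟨hρρl, hρρu⟩ : 0.010205144 ≤ ρ * ρ ∧ ρ * ρ ≤ 0.010205145 :=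
    mul_bounds hρl hρu hρl hρu (by norm_num) (by norm_num) (by norm_num) (by norm_num)
  obtain ⟨hρMl, hρMu⟩ : 0.001273694 ≤ ρ * (ρ * M₁) ∧ ρ * (ρ * M₁) ≤ 0.001273695 :=
    mul_bounds hρl hρu hRM1l hRM1u (by norm_num) (by norm_num) (by norm_num) (by norm_num)
  obtain ⟨hnHl, hnHu⟩ : 0.66940832 ≤ N₁ - ρ + ρ * N₁ - ρ * (ρ * M₁) - 1 * (ρ * M₁) + (L₁ - P₁) -
      0 * (ρ * (L₁ - P₁)) ∧
      N₁ - ρ + ρ * N₁ - ρ * (ρ * M₁) - 1 * (ρ * M₁) + (L₁ - P₁) -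
      0 * (ρ * (L₁ - P₁)) ≤ 0.669408372 := by
    constructor <;> linarith only [hN1l, hN1u, hρl, hρu, hRN1l, hRN1u, hρMl, hρMu, hRM1l, hRM1u,
      hL1l, hL1u, hP1l, hP1u]
  obtain ⟨hdHl, hdHu⟩ : 0.88877434 ≤ 1 - ρ * ρ - 1 * ρ - 0 * ρ ∧
      1 - ρ * ρ - 1 * ρ - 0 * ρ ≤ 0.888774342 := by
    constructor <;> linarith only [hρρl, hρρu, hρl, hρu]
  obtain ⟨hHl, hHu⟩ : 0.753181418 ≤ H₁ ∧ H₁ ≤ 0.75318148 :=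
    quotient_bounds r.H₁_eq hnHl hnHu hdHl hdHu (by norm_num) (by norm_num) (by norm_num)
      (by norm_num) (by norm_num)
  constructor <;> linarith only [hHl, hHu, hN1l, hN1u]

/-- Enclosure of the share for the alphabet `⊥, ⊤, →, ▷, □`. -/
theorem share_bounds_bot_top_imp_rhd_box {N₀ N₁ M₀ M₁ B₀ B₁ L₀ L₁ P₀ P₁ H₁ : ℝ}
    {ρ V : ℝ} (hρ : ρ = 9 - √80) (hV : V = (8 + √80) / 4)
    (h : ShareSystem 1 1 ρ V N₀ N₁ M₀ M₁ B₀ B₁ L₀ L₁ P₀ P₁ H₁) :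
    0.90519 ≤ H₁ + N₁ ∧ H₁ + N₁ < 0.90520 := by
  have hs : √80 * √80 = (80 : ℝ) := Real.mul_self_sqrt (by norm_num)
  have hsl : 8.944271909 ≤ √(80 : ℝ) := Real.le_sqrt_of_sq_le (by norm_num)
  have hsu : √(80 : ℝ) ≤ 8.94427191 := Real.sqrt_le_iff.2 (by norm_num)
  have hρV : 4 * ρ * V = 1 - 1 * ρ := by rw [hρ, hV]; linear_combination -hs
  have hρl : 0.05572809 ≤ ρ := by linarith
  have hρu : ρ ≤ 0.055728091 := by linarith
  have hVl : 4.236067977 ≤ V := by linarith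
  have hVu : V ≤ 4.236067978 := by linarith
  have r := h.reduced
  have eM₀ := r.M₀_eq
  have eM₁ := r.M₁_eq
  have eB₀ := r.B₀_eq
  have eB₁ := r.B₁_eq
  obtain ⟨hal, hau⟩ : 0.236067977 ≤ ρ * V ∧ ρ * V ≤ 0.236067978 := by
    constructor <;> linarith only [hρV, hρl, hρu]
  obtain ⟨hcl, hcu⟩ : 0.763932022 ≤ 1 - ρ * V ∧ 1 - ρ * V ≤ 0.763932023 := by
    constructor <;> linarith only [hal, hau]
  obtain ⟨hNl, hNu⟩ : 1.203378138 ≤ N₀ ∧ N₀ ≤ 1.203378142 :=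
    quadratic_bounds h.N₀_nonneg r.N₀_eq hρl hρu hcl hcu (by norm_num) (by norm_num)
      (by norm_num) (by norm_num) (by norm_num) (by norm_num)
  obtain ⟨hRNl, hRNu⟩ : 0.067061965 ≤ ρ * N₀ ∧ ρ * N₀ ≤ 0.067061967 :=
    mul_bounds hρl hρu hNl hNu (by norm_num) (by norm_num) (by norm_num) (by norm_num)
  obtain ⟨hdl, hdu⟩ : 0.898055952 ≤ 1 - ρ * V + 2 * (ρ * N₀) ∧
      1 - ρ * V + 2 * (ρ * N₀) ≤ 0.898055957 := by
    constructor <;> linarith only [hcl, hcu, hRNl, hRNu]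
  obtain ⟨hN1l, hN1u⟩ : 0.074674595 ≤ N₁ ∧ N₁ ≤ 0.074674598 :=
    quotient_bounds r.N₁_eq hRNl hRNu hdl hdu (by norm_num) (by norm_num) (by norm_num)
      (by norm_num) (by norm_num)
  obtain ⟨hMl, hMu⟩ : 0.270440103 ≤ M₀ ∧ M₀ ≤ 0.270440109 := by
    constructor <;> linarith only [eM₀, hNl, hNu, hRNl, hRNu]
  obtain ⟨hRN1l, hRN1u⟩ : 0.004161472 ≤ ρ * N₁ ∧ ρ * N₁ ≤ 0.004161473 :=
    mul_bounds hρl hρu hN1l hN1u (by norm_num) (by norm_num) (by norm_num) (by norm_num)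
  obtain ⟨hM1l, hM1u⟩ : 0.078836067 ≤ M₁ ∧ M₁ ≤ 0.078836071 := by
    constructor <;> linarith only [eM₁, hN1l, hN1u, hRN1l, hRN1u]
  obtain ⟨hRMl, hRMu⟩ : 0.01507111 ≤ ρ * M₀ ∧ ρ * M₀ ≤ 0.015071112 :=
    mul_bounds hρl hρu hMl hMu (by norm_num) (by norm_num) (by norm_num) (by norm_num)
  obtain ⟨hRM1l, hRM1u⟩ : 0.004393383 ≤ ρ * M₁ ∧ ρ * M₁ ≤ 0.004393384 :=
    mul_bounds hρl hρu hM1l hM1u (by norm_num) (by norm_num) (by norm_num) (by norm_num)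
  obtain ⟨hNMl, hNMu⟩ : 0.001010698 ≤ ρ * N₀ * (ρ * M₀) ∧ ρ * N₀ * (ρ * M₀) ≤ 0.001010699 :=
    mul_bounds hRNl hRNu hRMl hRMu (by norm_num) (by norm_num) (by norm_num) (by norm_num)
  obtain ⟨hN1Ml, hN1Mu⟩ : 0.000062718 ≤ ρ * N₁ * (ρ * M₀) ∧ ρ * N₁ * (ρ * M₀) ≤ 0.000062719 :=
    mul_bounds hRN1l hRN1u hRMl hRMu (by norm_num) (by norm_num) (by norm_num) (by norm_num)
  obtain ⟨hNM1l, hNM1u⟩ : 0.000294628 ≤ ρ * N₀ * (ρ * M₁) ∧ ρ * N₀ * (ρ * M₁) ≤ 0.000294629 :=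
    mul_bounds hRNl hRNu hRM1l hRM1u (by norm_num) (by norm_num) (by norm_num) (by norm_num)
  obtain ⟨hel, heu⟩ : 4.032689835 ≤ V + 1 - N₀ ∧ V + 1 - N₀ ≤ 4.03268984 := by
    constructor <;> linarith only [hVl, hVu, hNl, hNu]
  obtain ⟨hael, haeu⟩ : 0.951988931 ≤ ρ * V * (V + 1 - N₀) ∧ ρ * V * (V + 1 - N₀) ≤ 0.951988937 :=
    mul_bounds hal hau hel heu (by norm_num) (by norm_num) (by norm_num) (by norm_num)
  obtain ⟨haN1l, haN1u⟩ : 0.01762828 ≤ ρ * V * N₁ ∧ ρ * V * N₁ ≤ 0.017628282 :=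
    mul_bounds hal hau hN1l hN1u (by norm_num) (by norm_num) (by norm_num) (by norm_num)
  obtain ⟨hBl, hBu⟩ : 1.035132704 ≤ B₀ ∧ B₀ ≤ 1.035132715 := by
    constructor <;> linarith only [eB₀, hael, haeu, hNMl, hNMu, hRNl, hRNu, hRMl, hRMu]
  obtain ⟨hB1l, hB1u⟩ : 0.452085996 ≤ B₁ ∧ B₁ ≤ 0.452086007 := by
    constructor <;> linarith only [eB₁, hal, hau, hRNl, hRNu, haN1l, haN1u, hρl, hρu, hN1Ml,
      hN1Mu, hNM1l, hNM1u, hRN1l, hRN1u, hRM1l, hRM1u]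
  obtain ⟨hpl, hpu⟩ : 1.05572809 ≤ 1 + 1 * ρ ∧ 1 + 1 * ρ ≤ 1.055728091 := by
    constructor <;> linarith only [hρl, hρu]
  obtain ⟨hql, hqu⟩ : 3.271200681 ≤ 1 + 1 + B₀ + 1 * (ρ * V) ∧
      1 + 1 + B₀ + 1 * (ρ * V) ≤ 3.271200693 := by
    constructor <;> linarith only [hBl, hBu, hal, hau]
  obtain ⟨hLl, hLu⟩ : 3.902392233 ≤ L₀ ∧ L₀ ≤ 3.902392284 :=
    small_root_bounds h.L₀_le r.L₀_eq hρl hρu hpl hpu hql hqu (by linarith only [hau])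
      (by norm_num) (by norm_num) (by norm_num) (by norm_num) (by norm_num) (by norm_num)
  obtain ⟨hRLl, hRLu⟩ : 0.217472865 ≤ ρ * L₀ ∧ ρ * L₀ ≤ 0.217472873 :=
    mul_bounds hρl hρu hLl hLu (by norm_num) (by norm_num) (by norm_num) (by norm_num)
  obtain ⟨hnl, hnu⟩ : 0.507814086 ≤ B₁ + 1 * ρ ∧ B₁ + 1 * ρ ≤ 0.507814098 := by
    constructor <;> linarith only [hB1l, hB1u, hρl, hρu]
  obtain ⟨hdLl, hdLu⟩ : 0.620782344 ≤ 1 + 1 * ρ - 2 * (ρ * L₀) ∧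
      1 + 1 * ρ - 2 * (ρ * L₀) ≤ 0.620782361 := by
    constructor <;> linarith only [hρl, hρu, hRLl, hRLu]
  obtain ⟨hL1l, hL1u⟩ : 0.818022736 ≤ L₁ ∧ L₁ ≤ 0.818022779 :=
    quotient_bounds r.L₁_eq hnl hnu hdLl hdLu (by norm_num) (by norm_num) (by norm_num)
      (by norm_num) (by norm_num)
  obtain ⟨hcPl, hcPu⟩ : 0.782527127 ≤ 1 - ρ * L₀ ∧ 1 - ρ * L₀ ≤ 0.782527135 := by
    constructor <;> linarith only [hRLl, hRLu]
  obtain ⟨hPl, hPu⟩ : 1.178930165 ≤ P₀ ∧ P₀ ≤ 1.178930178 :=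
    quadratic_bounds h.P₀_nonneg r.P₀_eq hρl hρu hcPl hcPu (by norm_num) (by norm_num)
      (by norm_num) (by norm_num) (by norm_num) (by norm_num)
  obtain ⟨hRPl, hRPu⟩ : 0.065699526 ≤ ρ * P₀ ∧ ρ * P₀ ≤ 0.065699529 :=
    mul_bounds hρl hρu hPl hPu (by norm_num) (by norm_num) (by norm_num) (by norm_num)
  obtain ⟨hPLl, hPLu⟩ : 0.053743706 ≤ ρ * P₀ * L₁ ∧ ρ * P₀ * L₁ ≤ 0.053743712 :=
    mul_bounds hRPl hRPu hL1l hL1u (by norm_num) (by norm_num) (by norm_num) (by norm_num)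
  obtain ⟨hdPl, hdPu⟩ : 0.913926179 ≤ 1 - ρ * L₀ + 2 * (ρ * P₀) ∧
      1 - ρ * L₀ + 2 * (ρ * P₀) ≤ 0.913926193 := by
    constructor <;> linarith only [hcPl, hcPu, hRPl, hRPu]
  obtain ⟨hP1l, hP1u⟩ : 0.058805302 ≤ P₁ ∧ P₁ ≤ 0.05880531 :=
    quotient_bounds r.P₁_eq hPLl hPLu hdPl hdPu (by norm_num) (by norm_num) (by norm_num)
      (by norm_num) (by norm_num)
  obtain ⟨hρρl, hρρu⟩ : 0.00310562 ≤ ρ * ρ ∧ ρ * ρ ≤ 0.003105621 :=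
    mul_bounds hρl hρu hρl hρu (by norm_num) (by norm_num) (by norm_num) (by norm_num)
  obtain ⟨hρMl, hρMu⟩ : 0.000244834 ≤ ρ * (ρ * M₁) ∧ ρ * (ρ * M₁) ≤ 0.000244835 :=
    mul_bounds hρl hρu hRM1l hRM1u (by norm_num) (by norm_num) (by norm_num) (by norm_num)
  obtain ⟨hkl, hku⟩ : 0.759217426 ≤ L₁ - P₁ ∧ L₁ - P₁ ≤ 0.759217477 := by
    constructor <;> linarith only [hL1l, hL1u, hP1l, hP1u]
  obtain ⟨hρkl, hρku⟩ : 0.042309737 ≤ ρ * (L₁ - P₁) ∧ ρ * (L₁ - P₁) ≤ 0.042309741 :=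
    mul_bounds hρl hρu hkl hku (by norm_num) (by norm_num) (by norm_num) (by norm_num)
  obtain ⟨hnHl, hnHu⟩ : 0.735377442 ≤ N₁ - ρ + ρ * N₁ - ρ * (ρ * M₁) - 1 * (ρ * M₁) + (L₁ - P₁) -
      1 * (ρ * (L₁ - P₁)) ∧
      N₁ - ρ + ρ * N₁ - ρ * (ρ * M₁) - 1 * (ρ * M₁) + (L₁ - P₁) -
      1 * (ρ * (L₁ - P₁)) ≤ 0.735377504 := by
    constructor <;> linarith only [hN1l, hN1u, hρl, hρu, hRN1l, hRN1u, hρMl, hρMu, hRM1l, hRM1u,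
      hL1l, hL1u, hP1l, hP1u, hρkl, hρku]
  obtain ⟨hdHl, hdHu⟩ : 0.885438197 ≤ 1 - ρ * ρ - 1 * ρ - 1 * ρ ∧
      1 - ρ * ρ - 1 * ρ - 1 * ρ ≤ 0.8854382 := by
    constructor <;> linarith only [hρρl, hρρu, hρl, hρu]
  obtain ⟨hHl, hHu⟩ : 0.830523736 ≤ H₁ ∧ H₁ ≤ 0.830523809 :=
    quotient_bounds r.H₁_eq hnHl hnHu hdHl hdHu (by norm_num) (by norm_num) (by norm_num)
      (by norm_num) (by norm_num)
  constructor <;> linarith only [hHl, hHu, hN1l, hN1u]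

end IL

theorem theorem2 :
    (∃ μ : ℝ,
      IL.HasShare {IL.Symbol.bot, IL.Symbol.imp, IL.Symbol.rhd} IL.GLLike μ ∧
      0.93771 ≤ μ ∧ μ < 0.93772 ∧
      μ ≤ Filter.liminf
        (IL.shareAt {IL.Symbol.bot, IL.Symbol.imp, IL.Symbol.rhd} IL.HasGLEquivalent)
        Filter.atTop) ∧
    (∃ μ : ℝ,
      IL.HasShare {IL.Symbol.bot, IL.Symbol.imp, IL.Symbol.rhd, IL.Symbol.box} IL.GLLike μ ∧
      0.86653 ≤ μ ∧ μ < 0.86654 ∧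
      μ ≤ Filter.liminf
        (IL.shareAt {IL.Symbol.bot, IL.Symbol.imp, IL.Symbol.rhd, IL.Symbol.box}
          IL.HasGLEquivalent)
        Filter.atTop) ∧
    (∃ μ : ℝ,
      IL.HasShare {IL.Symbol.bot, IL.Symbol.top, IL.Symbol.imp, IL.Symbol.rhd, IL.Symbol.box}
        IL.GLLike μ ∧
      0.90519 ≤ μ ∧ μ < 0.90520 ∧
      μ ≤ Filter.liminf
        (IL.shareAt
          {IL.Symbol.bot, IL.Symbol.top, IL.Symbol.imp, IL.Symbol.rhd, IL.Symbol.box}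
          IL.HasGLEquivalent)
        Filter.atTop) := by
  refine ⟨?_, ?_, ?_⟩
  · obtain ⟨N₀, N₁, M₀, M₁, B₀, B₁, L₀, L₁, P₀, P₁, H₁, h, hs⟩ :=
      IL.exists_shareSystem (S := {IL.Symbol.bot, IL.Symbol.imp, IL.Symbol.rhd})
        (τ := 0) (β := 0) (ρ := 1 / 8) (V := 2) (by simp) (by simp) (by simp) (by simp) (by simp)
        (by norm_num) (by norm_num) (by norm_num) (by norm_num)
    obtain ⟨h₁, h₂⟩ := IL.share_bounds_bot_imp_rhd h
    exact ⟨_, hs, h₁, h₂, IL.le_liminf_shareAt hs fun F => IL.hasGLEquivalent_of_gllike⟩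
  · have hq : √24 * √24 = (24 : ℝ) := Real.mul_self_sqrt (by norm_num)
    have hl : 4.875 ≤ √(24 : ℝ) := Real.le_sqrt_of_sq_le (by norm_num)
    have hu : √(24 : ℝ) < 5 := (Real.sqrt_lt' (by norm_num)).2 (by norm_num)
    obtain ⟨N₀, N₁, M₀, M₁, B₀, B₁, L₀, L₁, P₀, P₁, H₁, h, hs⟩ :=
      IL.exists_shareSystem
        (S := {IL.Symbol.bot, IL.Symbol.imp, IL.Symbol.rhd, IL.Symbol.box})
        (τ := 0) (β := 1) (ρ := 5 - √24) (V := (4 + √24) / 4)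
        (by simp) (by simp) (by simp) (by simp) (by simp)
        (by linarith) (by linarith) (by linear_combination hq) (by linear_combination -hq)
    obtain ⟨h₁, h₂⟩ := IL.share_bounds_bot_imp_rhd_box rfl rfl h
    exact ⟨_, hs, h₁, h₂, IL.le_liminf_shareAt hs fun F => IL.hasGLEquivalent_of_gllike⟩
  · have hq : √80 * √80 = (80 : ℝ) := Real.mul_self_sqrt (by norm_num)
    have hl : 8.875 ≤ √(80 : ℝ) := Real.le_sqrt_of_sq_le (by norm_num)
    have hu : √(80 : ℝ) < 9 := (Real.sqrt_lt' (by norm_num)).2 (by norm_num)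
    obtain ⟨N₀, N₁, M₀, M₁, B₀, B₁, L₀, L₁, P₀, P₁, H₁, h, hs⟩ :=
      IL.exists_shareSystem
        (S := {IL.Symbol.bot, IL.Symbol.top, IL.Symbol.imp, IL.Symbol.rhd, IL.Symbol.box})
        (τ := 1) (β := 1) (ρ := 9 - √80) (V := (8 + √80) / 4)
        (by simp) (by simp) (by simp) (by simp) (by simp)
        (by linarith) (by linarith) (by linear_combination hq) (by linear_combination -hq)
    obtain ⟨h₁, h₂⟩ := IL.share_bounds_bot_top_imp_rhd_box rfl rfl h
    exact ⟨_, hs, h₁, h₂, IL.le_liminf_shareAt hs fun F => IL.hasGLEquivalent_of_gllike⟩
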